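/- Let $n\ge 2$ and let $\mathcal O_n$ be the Cuntz algebra, the unital $C^*$-algebra generated by isometries $S_1,\dots,S_n$ with $\sum_{i=1}^n S_iS_i^*=1$. For a multi-index $\mu=(\mu_1,\dots,\mu_k)$ with entries in $\{1,\dots,n\}$ put $|\mu|=k$ and $S_\mu=S_{\mu_1}\cdots S_{\mu_k}$ (with $S_\emptyset=1$). Let $\mathcal F_n$ be the $C^*$-subalgebra of $\mathcal O_n$ generated by all $S_\mu S_\nu^*$ with $|\mu|=|\nu|$, and let $\mathcal D_n$ be the $C^*$-subalgebra generated by all projections $S_\mu S_\mu^*$; its spectrum is identified with the one-sided shift space $X_n=\{1,\dots,n\}^{\mathbb N}$, $S_\mu S_\mu^*$ corresponding to the indicator function of the set of sequences that begin with $\mu$. Let $\mathcal P_n$ be the set of unitaries in $\mathcal F_n$ that are finite sums of elements $S_\mu S_\nu^*$. Let $\lambda(\mathcal P_n)^{-1}$ be the set of automorphisms $\alpha$ of $\mathcal O_n$ for which there is $u\in\mathcal P_n$ with $\alpha(S_i)=uS_i$ for $i=1,\dots,n$, and let $\operatorname{Inn}\lambda(\mathcal P_n)^{-1}=\{\operatorname{Ad}(u):u\in\mathcal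 P_n\}$. Let $\operatorname{Aut}(\Sigma_n)$ be the group of homeomorphisms of the two-sided shift space $\Sigma_n=\{1,\dots,n\}^{\mathbb Z}$ that commute with the shift $\sigma$, $(\sigma z)_k=z_{k+1}$, and let $\langle\sigma\rangle$ be its subgroup generated by $\sigma$. Then $\lambda(\mathcal P_n)^{-1}$ is a subgroup of $\operatorname{Aut}(\mathcal O_n)$ with normal subgroup $\operatorname{Inn}\lambda(\mathcal P_n)^{-1}$, and there is a natural injective group homomorphism $$\Psi:\lambda(\mathcal P_n)^{-1}/\operatorname{Inn}\lambda(\mathcal P_n)^{-1}\longrightarrow \operatorname{Aut}(\Sigma_n)/\langle\sigma\rangle .$$ It is natural in the following sense: every $\alpha\in\lambda(\mathcal P_n)^{-1}$ maps $\mathcal D_n\cong C(X_n)$ into itself by $a\mapsto a\circ f^{-1}$ for some homeomorphism $f$ of $X_n$, and $\Psi$ sends the class of $\alpha$ to the class of some $g\in\operatorname{Aut}(\Sigma_n)$ for which there is an $m\in\mathbb N$ such that $g(z)_k=f(z_0z_1z_2\dots)_k$ for all $z\in\Sigma_n$ and all $k\ge m$. If $n$ is prime, then $\Psi$ is surjective,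 and hence an isomorphism of groups. -/

import Mathlib

namespace Cuntz

/-! ### Full shifts -/

/-- The full one-sided `n`-shift space `X_n`, with the product topology. -/
abbrev OneSided (n : ℕ) : Type := ℕ → Fin n

/-- The full two-sided `n`-shift space `Σ_n`, with the product topology. -/
abbrev TwoSided (n : ℕ) : Type := ℤ → Fin n

/-- The sequence `i x₀ x₁ x₂ …`. -/
def prepend {n : ℕ} (i : Fin n) (x : OneSided n) : OneSided n
  | 0 => i
  | k + 1 => x k

theorem prepend_inj {n : ℕ} {i j : Fin n} {x y : OneSided n} :
    prepend i x = prepend j y ↔ i = j ∧ x = y := by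
  constructor
  · intro h
    exact ⟨congrFun h 0, funext fun k => congrFun h (k + 1)⟩
  · rintro ⟨rfl, rfl⟩
    rfl

theorem prepend_head_tail {n : ℕ} (x : OneSided n) :
    prepend (x 0) (fun k => x (k + 1)) = x := by
  funext k
  cases k <;> rfl

/-- The two-sided shift `σ`, `(σ z)ₖ = zₖ₊₁`, as a homeomorphism of `Σ_n`. -/
def shift (n : ℕ) : TwoSided n ≃ₜ TwoSided n where
  toFun z k := z (k + 1)
  invFun z k := z (k - 1)
  left_inv z := by funext k; simp
  right_inv z := by funext k; simp
  continuous_toFun := by fun_prop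
  continuous_invFun := by fun_prop

/-- `Aut(Σ_n)`: the homeomorphisms of `Σ_n` that commute with the shift. -/
abbrev ShiftAut (n : ℕ) : Subgroup (TwoSided n ≃ₜ TwoSided n) :=
  Subgroup.centralizer {shift n}

/-- The shift as an element of `Aut(Σ_n)`. -/
def shiftMem (n : ℕ) : ShiftAut n :=
  ⟨shift n, by simp [Subgroup.mem_centralizer_iff]⟩

/-- The subgroup `⟨σ⟩` of `Aut(Σ_n)`. -/
abbrev shiftPowers (n : ℕ) : Subgroup (ShiftAut n) :=
  Subgroup.zpowers (shiftMem n)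

instance shiftPowers_normal (n : ℕ) : (shiftPowers n).Normal := by
  have hc : shiftPowers n ≤ Subgroup.center (ShiftAut n) := by
    rw [Subgroup.zpowers_le, Subgroup.mem_center_iff]
    intro g
    apply Subtype.ext
    exact (Subgroup.mem_centralizer_iff.mp g.2 (shift n) rfl).symm
  constructor
  intro h hh g
  rw [Subgroup.mem_center_iff.mp (hc hh) g, mul_inv_cancel_right]
  exact hh

/-! ### The Cuntz algebra -/

noncomputable section

open scoped Classical

/-- The Hilbert space `ℓ²(X_n)`, with canonical orthonormal basis `e_x`, `x ∈ X_n`. -/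
abbrev Hilb (n : ℕ) : Type := lp (fun _ : OneSided n => ℂ) 2

/-- The basis vector `e_x`. -/
def basisVec {n : ℕ} (x : OneSided n) : Hilb n := lp.single 2 x 1

theorem inner_basisVec {n : ℕ} (x y : OneSided n) :
    inner ℂ (basisVec x) (basisVec y) = if x = y then 1 else 0 := by
  unfold basisVec
  rw [lp.inner_single_left, lp.single_apply]
  by_cases h : x = y
  · subst h; simp
  · simp [h]

theorem orthonormal_prepend {n : ℕ} (i : Fin n) :
    Orthonormal ℂ (fun x : OneSided n => basisVec (prepend i x)) := by
  rw [orthonormal_iff_ite]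
  intro x y
  rw [inner_basisVec]
  simp [prepend_inj]

/-- The isometry `e_x ↦ e_{ix}` of `ℓ²(X_n)`. -/
def isomOp {n : ℕ} (i : Fin n) : Hilb n →L[ℂ] Hilb n :=
  (orthonormal_prepend i).orthogonalFamily.linearIsometry.toContinuousLinearMap

theorem isomOp_basisVec {n : ℕ} (i : Fin n) (x : OneSided n) :
    isomOp i (basisVec x) = basisVec (prepend i x) := by
  simp [isomOp, basisVec]

theorem ext_basisVec {n : ℕ} {S T : Hilb n →L[ℂ] Hilb n}
    (h : ∀ x, S (basisVec x) = T (basisVec x)) : S = T := by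
  ext1 v
  have hv := lp.hasSum_single (p := 2) (by norm_num) v
  have key : ∀ x, S (lp.single 2 x (v x)) = T (lp.single 2 x (v x)) := by
    intro x
    have : (lp.single 2 x (v x) : Hilb n) = (v x) • basisVec x := by
      rw [basisVec, ← lp.single_smul]; simp
    rw [this, map_smul, map_smul, h]
  have h1 := S.hasSum hv
  have h2 := T.hasSum hv
  simp only [key] at h1
  exact h1.unique h2

theorem star_isomOp_basisVec {n : ℕ} (i j : Fin n) (x : OneSided n) :
    star (isomOp i) (basisVec (prepend j x)) = if i = j then basisVec x else 0 := by
  rw [ContinuousLinearMap.star_eq_adjoint]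
  ext y
  have h : ∀ w : Hilb n, w y = inner ℂ (basisVec y) w := by
    intro w
    rw [basisVec, lp.inner_single_left]
    simp
  rw [h, h, ContinuousLinearMap.adjoint_inner_right, isomOp_basisVec, inner_basisVec, prepend_inj]
  by_cases hij : i = j
  · simp [hij, inner_basisVec]
  · simp [hij]

theorem star_isomOp_mul {n : ℕ} (i j : Fin n) :
    star (isomOp i) * isomOp j = if i = j then 1 else 0 := by
  apply ext_basisVec
  intro x
  rw [mul_apply_eq_comp, isomOp_basisVec, star_isomOp_basisVec]
  split_ifs <;> simp

theorem sum_isomOp_mul_star (n : ℕ) :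
    ∑ i : Fin n, isomOp i * star (isomOp i) = 1 := by
  apply ext_basisVec
  intro x
  rw [← prepend_head_tail x]
  simp only [sum_apply, mul_apply_eq_comp, star_isomOp_basisVec]
  rw [Finset.sum_eq_single (x 0)]
  · simp [isomOp_basisVec]
  · intro b _ hb
    simp [hb]
  · simp

/-- The Cuntz algebra `𝒪_n`: the unital C⋆-algebra generated by `n` isometries whose range
projections sum to `1`, realized as the closed unital ⋆-subalgebra of `B(ℓ²(X_n))` generated by
the isometries `e_x ↦ e_{ix}`, `i = 1, …, n`. For `n ≥ 2` any other choice of such isometries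
generates an isomorphic C⋆-algebra, by an isomorphism that matches the generators. -/
def algebra (n : ℕ) : StarSubalgebra ℂ (Hilb n →L[ℂ] Hilb n) :=
  (StarAlgebra.adjoin ℂ (Set.range (isomOp (n := n)))).topologicalClosure

/-- The underlying type of `𝒪_n`. -/
abbrev On (n : ℕ) : Type := algebra n

/-- The generator `S_i` of `𝒪_n`. -/
def S {n : ℕ} (i : Fin n) : On n :=
  ⟨isomOp i, StarSubalgebra.le_topologicalClosure _ (StarAlgebra.subset_adjoin ℂ _ ⟨i, rfl⟩)⟩

theorem star_S_mul_S {n : ℕ} (i : Fin n) : star (S i) * S i = 1 := by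
  apply Subtype.ext
  simpa [S] using star_isomOp_mul i i

theorem sum_S_mul_star_S (n : ℕ) : ∑ i : Fin n, S i * star (S i) = 1 := by
  apply Subtype.ext
  simpa [S] using sum_isomOp_mul_star n

/-- `S_μ = S_{μ₁} ⋯ S_{μ_k}` for a multi-index `μ`, with `S_∅ = 1`. -/
def word {n : ℕ} (μ : List (Fin n)) : On n := (μ.map S).prod

/-- The core UHF-subalgebra `ℱ_n`, the closure of `⋃ₖ ℱ_n^k`, where `ℱ_n^k` is spanned by the
`S_μ S_ν⋆` with `|μ| = |ν| = k`. -/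
def core (n : ℕ) : StarSubalgebra ℂ (On n) :=
  (StarAlgebra.adjoin ℂ {a : On n | ∃ μ ν : List (Fin n),
    μ.length = ν.length ∧ a = word μ * star (word ν)}).topologicalClosure

/-- The diagonal `𝒟_n`, generated by the projections `P_μ = S_μ S_μ⋆`. -/
def diagonal (n : ℕ) : StarSubalgebra ℂ (On n) :=
  (StarAlgebra.adjoin ℂ {a : On n | ∃ μ : List (Fin n),
    a = word μ * star (word μ)}).topologicalClosure

/-- `𝒮_n`: the unitaries of `𝒪_n` that are finite sums of words `S_μ S_ν⋆`. -/
def wordUnitaries (n : ℕ) : Set (On n) :=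
  {u | u ∈ unitary (On n) ∧ ∃ (m : ℕ) (μ ν : Fin m → List (Fin n)),
    u = ∑ j, word (μ j) * star (word (ν j))}

/-- `𝒫_n = 𝒮_n ∩ 𝒰(ℱ_n)`, the permutation unitaries. -/
def permUnitaries (n : ℕ) : Set (On n) :=
  {u | u ∈ wordUnitaries n ∧ u ∈ core n}

/-- `λ(𝒫_n)⁻¹`: the automorphisms of `𝒪_n` of the form `λ_u` with `u ∈ 𝒫_n`, where
`λ_u(S_i) = u S_i` for all `i`. -/
def weylSet (n : ℕ) : Set (On n ≃⋆ₐ[ℂ] On n) :=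
  {α | ∃ u ∈ permUnitaries n, ∀ i : Fin n, α (S i) = u * S i}

/-- `Inn λ(𝒫_n)⁻¹`: the automorphisms `Ad(u)`, `u ∈ 𝒫_n`. -/
def innerSet (n : ℕ) : Set (On n ≃⋆ₐ[ℂ] On n) :=
  {α | ∃ u ∈ permUnitaries n, ∀ a : On n, α a = u * a * star u}

/-! ### Naturality -/

/-- `⟨e_x, a e_x⟩`. On `𝒟_n` this is the character with `P_μ ↦ 1` if `μ` is an initial segment of
`x`, and `P_μ ↦ 0` otherwise; it gives the identification of `X_n` with the spectrum of `𝒟_n`. -/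
def diagEval {n : ℕ} (x : OneSided n) (a : On n) : ℂ :=
  inner ℂ (basisVec x) ((a : Hilb n →L[ℂ] Hilb n) (basisVec x))

/-- The automorphism `α` of `𝒪_n` maps `𝒟_n ≅ C(X_n)` to itself, by `a ↦ a ∘ f⁻¹`. -/
def Induces {n : ℕ} (α : On n ≃⋆ₐ[ℂ] On n) (f : OneSided n ≃ₜ OneSided n) : Prop :=
  ∀ a ∈ diagonal n, α a ∈ diagonal n ∧ ∀ x, diagEval x (α a) = diagEval (f.symm x) a

/-- The right half `z₀ z₁ z₂ …` of a two-sided sequence. -/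
def rightHalf {n : ℕ} (z : TwoSided n) : OneSided n := fun k => z k

/-- `f : X_n → X_n` and `g : Σ_n → Σ_n` act in the same way on all coordinates `≥ m`, for some `m`
that does not depend on the point. -/
def EventuallyAgree {n : ℕ} (f : OneSided n ≃ₜ OneSided n) (g : TwoSided n ≃ₜ TwoSided n) : Prop :=
  ∃ m : ℕ, ∀ z : TwoSided n, ∀ k : ℕ, m ≤ k → f (rightHalf z) k = g z k

end

end Cuntz

namespace Cuntz

/-! ### Finite dependence of locally constant functions -/

/-! On `ℓ²(X_n)` everything becomes combinatorial. A permutation unitary is the operator `permOp τ`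
of a homeomorphism `τ` that leaves all far coordinates alone (`IsLocal`), and conversely
(`exists_isLocal_of_mem_permUnitaries`, `exists_permUnitary_of_isLocal`). The proof identifies
`λ(𝒫_n)⁻¹` with `commGroup n`, the homeomorphisms `f` of `X_n` that, with their inverses, commute
with the shift on far coordinates; `f` acts by conjugation with `permOp f`.

One direction is direct: conjugation by `permOp f` sends `S_i` to `u S_i`, where `u` is the
permutation operator of the local map `cocycle f`. For the other, let `α = λ_u` with `u = permOp τ`.
The map `step τ = σ ∘ τ⁻¹` has an itinerary map `itin τ` that turns `y ↦ τ(i y)` into `x ↦ i x`. It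
is onto by compactness, and one-to-one because `α` is onto (`injective_itin`); its inverse is the
required `f`. That `itin τ` eventually commutes with the shift comes from approximating `α⁻¹(u⋆)` by
a finite combination of words (`eventuallyCommutes_itin`). Under this identification the inner
automorphisms `Ad(u)` are exactly the local `f` (`mem_innerSet_iff`).

Shift equivariance gives each `f` in `commGroup n` a unique two-sided extension. If it is a power of
the shift, then `σ^b ∘ f = σ^a`, and counting fibres forces `a = b`, so `f` is local
(`toShiftAut_mem_shiftPowers_iff`). This makes `Ψ` well defined and injective.

For surjectivity, a shifted two-sided automorphism and its shifted inverse induce one-sided maps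
`q`, `q'` with `q q' = q' q = σ^p`. An extremal argument shows that the fibres of `q` all have the
same size, a divisor of `n^p` (`InversePair.exists_degree_eq`). For prime `n` it is `n^a`, and
labelling the points of each fibre by words of length `a` factors `q` as `σ^a ∘ f`
(`InversePair.exists_homeomorph`). -/

theorem exists_finset_dependence {ι A B : Type*} [TopologicalSpace A] [DiscreteTopology A]
    [Finite A] [TopologicalSpace B] [DiscreteTopology B] {φ : (ι → A) → B} (hφ : Continuous φ) :
    ∃ F : Finset ι, ∀ x y : ι → A, (∀ i ∈ F, x i = y i) → φ x = φ y := by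
  classical
  have hloc : ∀ x : ι → A, ∃ F : Finset ι, ∀ y : ι → A, (∀ i ∈ F, y i = x i) → φ y = φ x := by
    intro x
    have ho : IsOpen (φ ⁻¹' {φ x}) := (isOpen_discrete _).preimage hφ
    obtain ⟨F, u, hu, hsub⟩ := isOpen_pi_iff.mp ho x rfl
    refine ⟨F, fun y hy => hsub ?_⟩
    intro i hi
    rw [hy i hi]
    exact (hu i hi).2
  choose F hF using hloc
  have hopen : ∀ x : ι → A, IsOpen {y : ι → A | ∀ i ∈ F x, y i = x i} := by
    intro x
    have : {y : ι → A | ∀ i ∈ F x, y i = x i} = (F x : Set ι).pi fun i => {x i} := by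
      ext y; simp
    rw [this]
    exact isOpen_set_pi (F x).finite_toSet fun i _ => isOpen_discrete _
  obtain ⟨t, ht⟩ := isCompact_univ.elim_finite_subcover _ hopen
    (fun x _ => Set.mem_iUnion.mpr ⟨x, fun i _ => rfl⟩)
  refine ⟨t.biUnion F, fun x y hxy => ?_⟩
  obtain ⟨z, hz, hxz⟩ := Set.mem_iUnion₂.mp (ht (Set.mem_univ x))
  have hyz : ∀ i ∈ F z, y i = z i := fun i hi => by
    rw [← hxy i (Finset.mem_biUnion.mpr ⟨z, hz, hi⟩)]
    exact hxz i hi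
  rw [hF z x hxz, hF z y hyz]

/-- A locally constant function on `X_n` only depends on an initial segment. -/
theorem exists_prefix_dependence {n : ℕ} {B : Type*} [TopologicalSpace B] [DiscreteTopology B]
    {φ : OneSided n → B} (hφ : Continuous φ) :
    ∃ M : ℕ, ∀ x y : OneSided n, (∀ i < M, x i = y i) → φ x = φ y := by
  obtain ⟨F, hF⟩ := exists_finset_dependence hφ
  refine ⟨F.sup id + 1, fun x y h => hF x y fun i hi => h i ?_⟩
  exact Nat.lt_succ_of_le (Finset.le_sup (f := id) hi)

/-! ### The one-sided shift -/

/-- The sequence `xₘ xₘ₊₁ xₘ₊₂ …`, that is, the `m`-th iterate of the one-sided shift. -/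
def drop {n : ℕ} (m : ℕ) (x : OneSided n) : OneSided n := fun k => x (k + m)

theorem drop_apply {n : ℕ} (m : ℕ) (x : OneSided n) (k : ℕ) : drop m x k = x (k + m) := rfl

@[simp] theorem drop_zero {n : ℕ} (x : OneSided n) : drop 0 x = x := rfl

theorem drop_drop {n : ℕ} (a b : ℕ) (x : OneSided n) : drop a (drop b x) = drop (a + b) x := by
  funext k
  simp only [drop_apply, add_assoc]

@[simp] theorem drop_one_prepend {n : ℕ} (i : Fin n) (x : OneSided n) :
    drop 1 (prepend i x) = x := rfl

@[simp] theorem prepend_zero {n : ℕ} (i : Fin n) (x : OneSided n) : prepend i x 0 = i := rfl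

theorem prepend_drop_one {n : ℕ} (x : OneSided n) : prepend (x 0) (drop 1 x) = x :=
  prepend_head_tail x

theorem iterate_drop_one {n : ℕ} (m : ℕ) (x : OneSided n) : (drop 1)^[m] x = drop m x := by
  induction m with
  | zero => rfl
  | succ m ih => rw [Function.iterate_succ_apply', ih, drop_drop, add_comm]

@[fun_prop] theorem continuous_drop {n : ℕ} (m : ℕ) : Continuous (drop (n := n) m) :=
  continuous_pi fun k => continuous_apply (k + m)

theorem drop_eq_of_le {n m m' : ℕ} (h : m ≤ m') {x y : OneSided n} (hxy : drop m x = drop m y) :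
    drop m' x = drop m' y := by
  obtain ⟨c, rfl⟩ := Nat.exists_eq_add_of_le' h
  rw [← drop_drop, hxy, drop_drop]

theorem apply_eq_of_drop_eq {n m : ℕ} {x y : OneSided n} (h : drop m x = drop m y) {k : ℕ}
    (hk : m ≤ k) : x k = y k := by
  obtain ⟨c, rfl⟩ := Nat.exists_eq_add_of_le' hk
  exact congrFun h c

theorem drop_eq_iff {n m : ℕ} {x y : OneSided n} :
    drop m x = drop m y ↔ ∀ k, m ≤ k → x k = y k :=
  ⟨fun h _ hk => apply_eq_of_drop_eq h hk, fun h => funext fun k => h _ (Nat.le_add_left m k)⟩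

/-- The sequence that agrees with `w` below `m` and continues with `y` from there. -/
def splice {n : ℕ} (m : ℕ) (w : ℕ → Fin n) (y : OneSided n) : OneSided n :=
  fun k => if k < m then w k else y (k - m)

@[simp] theorem drop_splice {n : ℕ} (m : ℕ) (w : ℕ → Fin n) (y : OneSided n) :
    drop m (splice m w y) = y := by
  funext k
  simp [drop_apply, splice]

theorem splice_of_lt {n m k : ℕ} (h : k < m) (w : ℕ → Fin n) (y : OneSided n) :
    splice m w y k = w k := by
  simp [splice, h]

/-! ### Maps that eventually commute with the shift -/

/-- `f (σ x)` and `σ (f x)` agree on all coordinates `≥ m`, for an `m` that does not depend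
on `x`. -/
def EventuallyCommutes {n : ℕ} (f : OneSided n → OneSided n) : Prop :=
  ∃ m : ℕ, ∀ x k, m ≤ k → f x (k + 1) = f (drop 1 x) k

theorem apply_add_of_eventuallyCommutes {n m : ℕ} {f : OneSided n → OneSided n}
    (hf : ∀ x k, m ≤ k → f x (k + 1) = f (drop 1 x) k) (j : ℕ) (x : OneSided n) {k : ℕ}
    (hk : m ≤ k) : f x (k + j) = f (drop j x) k := by
  induction j generalizing x k with
  | zero => rfl
  | succ j ih =>
    rw [← add_assoc, hf x (k + j) (by omega), ih (drop 1 x) hk, drop_drop]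

/-- Past `m + j`, the output can be read off from `f` applied to the `j`-th shift of the input, so
it sees only the tail. -/
theorem apply_eq_of_eventuallyCommutes {n m j k : ℕ} {f : OneSided n → OneSided n}
    (hf : ∀ x k, m ≤ k → f x (k + 1) = f (drop 1 x) k) {x y : OneSided n}
    (hxy : drop j x = drop j y) (hk : m + j ≤ k) : f x k = f y k := by
  obtain ⟨c, rfl⟩ := Nat.exists_eq_add_of_le hk
  have e : m + j + c = (m + c) + j := by omega
  rw [e, apply_add_of_eventuallyCommutes hf j x (by omega),
    apply_add_of_eventuallyCommutes hf j y (by omega), hxy]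

theorem EventuallyCommutes.comp {n : ℕ} {f g : OneSided n → OneSided n}
    (hf : EventuallyCommutes f) (hg : EventuallyCommutes g) : EventuallyCommutes (f ∘ g) := by
  obtain ⟨a, ha⟩ := hf
  obtain ⟨b, hb⟩ := hg
  refine ⟨a + b, fun x k hk => ?_⟩
  simp only [Function.comp_apply]
  rw [ha _ _ (by omega)]
  refine apply_eq_of_eventuallyCommutes ha (j := b) ?_ hk
  rw [drop_eq_iff]
  intro i hi
  exact hb x i hi

/-- The group of homeomorphisms of `X_n` that, together with their inverses, eventually commute
with the shift. -/
def commGroup (n : ℕ) : Subgroup (OneSided n ≃ₜ OneSided n) where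
  carrier := {f | EventuallyCommutes f ∧ EventuallyCommutes f.symm}
  one_mem' := ⟨⟨0, fun _ _ _ => rfl⟩, ⟨0, fun _ _ _ => rfl⟩⟩
  mul_mem' := fun ha hb => ⟨ha.1.comp hb.1, hb.2.comp ha.2⟩
  inv_mem' := fun ha => ⟨ha.2, ha.1⟩

/-- The map `f` does not change the coordinates `≥ m`, for some `m`. -/
def IsLocal {n : ℕ} (f : OneSided n → OneSided n) : Prop :=
  ∃ m : ℕ, ∀ x, drop m (f x) = drop m x

theorem IsLocal.symm {n : ℕ} {f : OneSided n ≃ OneSided n} (hf : IsLocal f) :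
    IsLocal f.symm := by
  obtain ⟨m, hm⟩ := hf
  refine ⟨m, fun x => ?_⟩
  rw [← hm (f.symm x), f.apply_symm_apply]

theorem IsLocal.eventuallyCommutes {n : ℕ} {f : OneSided n → OneSided n} (hf : IsLocal f) :
    EventuallyCommutes f := by
  obtain ⟨m, hm⟩ := hf
  refine ⟨m, fun x k hk => ?_⟩
  rw [apply_eq_of_drop_eq (hm x) (by omega : m ≤ k + 1), apply_eq_of_drop_eq (hm (drop 1 x)) hk,
    drop_apply]

theorem IsLocal.mem_commGroup {n : ℕ} {f : OneSided n ≃ₜ OneSided n} (hf : IsLocal f) :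
    f ∈ commGroup n :=
  ⟨hf.eventuallyCommutes, (IsLocal.symm (f := f.toEquiv) hf).eventuallyCommutes⟩

/-- The homeomorphism `i x ↦ f (i f⁻¹(x))`. -/
def cocycle {n : ℕ} (f : OneSided n ≃ₜ OneSided n) : OneSided n ≃ₜ OneSided n where
  toFun x := f (prepend (x 0) (f.symm (drop 1 x)))
  invFun y := prepend (f.symm y 0) (f (drop 1 (f.symm y)))
  left_inv x := by simp [prepend_drop_one]
  right_inv y := by simp [prepend_drop_one]
  continuous_toFun := by
    refine f.continuous.comp (continuous_pi fun k => ?_)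
    cases k with
    | zero => exact continuous_apply 0
    | succ k =>
      exact (continuous_apply k).comp (f.symm.continuous.comp (continuous_drop 1))
  continuous_invFun := by
    refine continuous_pi fun k => ?_
    cases k with
    | zero => exact (continuous_apply 0).comp f.symm.continuous
    | succ k =>
      exact (continuous_apply k).comp
        (f.continuous.comp ((continuous_drop 1).comp f.symm.continuous))

theorem cocycle_prepend {n : ℕ} (f : OneSided n ≃ₜ OneSided n) (i : Fin n) (x : OneSided n) :
    cocycle f (prepend i x) = f (prepend i (f.symm x)) := rfl

/-- Far out, `σ f (i f⁻¹ x)` agrees with `f (f⁻¹ x) = x`. The permutation operator of this map is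
the `u` for which conjugation by `permOp f` is `λ_u`. -/
theorem isLocal_cocycle {n : ℕ} {f : OneSided n ≃ₜ OneSided n} (hf : EventuallyCommutes f) :
    IsLocal (cocycle f) := by
  obtain ⟨m, hm⟩ := hf
  refine ⟨m + 1, fun x => funext fun k => ?_⟩
  rw [← prepend_drop_one x, cocycle_prepend]
  simp only [drop_apply, prepend_drop_one]
  rw [← add_assoc, hm _ _ (by omega), drop_one_prepend, f.apply_symm_apply, drop_apply]

end Cuntz

namespace Cuntz

noncomputable section

open scoped Classical

/-! ### Basis vectors and permutation operators -/

theorem apply_eq_inner {n : ℕ} (w : Hilb n) (y : OneSided n) :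
    w y = inner ℂ (basisVec y) w := by
  rw [basisVec, lp.inner_single_left]
  simp

theorem basisVec_apply {n : ℕ} (x y : OneSided n) :
    (basisVec x : Hilb n) y = if y = x then 1 else 0 := by
  rw [apply_eq_inner, inner_basisVec]

theorem basisVec_injective {n : ℕ} : Function.Injective (basisVec (n := n)) := by
  intro x y h
  by_contra hxy
  have := basisVec_apply x x
  rw [h, basisVec_apply] at this
  simp [hxy] at this

theorem norm_basisVec {n : ℕ} (x : OneSided n) : ‖(basisVec x : Hilb n)‖ = 1 := by
  rw [basisVec, lp.norm_single (by norm_num)]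
  simp

theorem norm_apply_le {n : ℕ} (w : Hilb n) (y : OneSided n) : ‖w y‖ ≤ ‖w‖ := by
  rw [apply_eq_inner]
  simpa [norm_basisVec] using norm_inner_le_norm (𝕜 := ℂ) (basisVec y) w

theorem norm_coeff_le {n : ℕ} (a : Hilb n →L[ℂ] Hilb n) (x y : OneSided n) :
    ‖a (basisVec x) y‖ ≤ ‖a‖ := by
  refine (norm_apply_le _ _).trans ?_
  simpa [norm_basisVec] using a.le_opNorm (basisVec x)

theorem star_coeff {n : ℕ} (a : Hilb n →L[ℂ] Hilb n) (x y : OneSided n) :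
    star a (basisVec x) y = starRingEnd ℂ (a (basisVec y) x) := by
  rw [apply_eq_inner, apply_eq_inner, ContinuousLinearMap.star_eq_adjoint,
    ContinuousLinearMap.adjoint_inner_right, inner_conj_symm]

theorem mul_coeff {n : ℕ} (a b : Hilb n →L[ℂ] Hilb n) (x y : OneSided n) :
    (a * b) (basisVec x) y = inner ℂ (star a (basisVec y)) (b (basisVec x)) := by
  rw [apply_eq_inner, ContinuousLinearMap.star_eq_adjoint,
    ContinuousLinearMap.adjoint_inner_left]
  rfl

theorem exists_of_inner_ne_zero {n : ℕ} {v w : Hilb n} (h : inner ℂ v w ≠ 0) :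
    ∃ y, v y ≠ 0 ∧ w y ≠ 0 := by
  by_contra! hc
  apply h
  rw [lp.inner_eq_tsum]
  convert tsum_zero with y
  by_cases hv : v y = 0
  · simp [hv]
  · simp [hc y hv]

theorem orthonormal_perm {n : ℕ} (f : OneSided n ≃ OneSided n) :
    Orthonormal ℂ (fun x : OneSided n => (basisVec (f x) : Hilb n)) := by
  rw [orthonormal_iff_ite]
  intro x y
  rw [inner_basisVec]
  simp

/-- The unitary `e_x ↦ e_{f(x)}` of `ℓ²(X_n)`. -/
def permOp {n : ℕ} (f : OneSided n ≃ OneSided n) : Hilb n →L[ℂ] Hilb n :=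
  (orthonormal_perm f).orthogonalFamily.linearIsometry.toContinuousLinearMap

theorem permOp_basisVec {n : ℕ} (f : OneSided n ≃ OneSided n) (x : OneSided n) :
    permOp f (basisVec x) = basisVec (f x) := by
  simp [permOp, basisVec]

theorem star_permOp {n : ℕ} (f : OneSided n ≃ OneSided n) :
    star (permOp f) = permOp f.symm := by
  apply ext_basisVec
  intro x
  ext y
  rw [star_coeff, permOp_basisVec, permOp_basisVec, basisVec_apply, basisVec_apply]
  by_cases h : x = f y
  · simp [h]
  · rw [if_neg h, if_neg (fun h' => h (by rw [h', f.apply_symm_apply]))]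
    simp

theorem permOp_mul {n : ℕ} (f g : OneSided n ≃ OneSided n) :
    permOp f * permOp g = permOp (g.trans f) := by
  apply ext_basisVec
  intro x
  simp [permOp_basisVec]

theorem permOp_refl {n : ℕ} : permOp (Equiv.refl (OneSided n)) = 1 := by
  apply ext_basisVec
  intro x
  simp [permOp_basisVec]

theorem permOp_mul_star {n : ℕ} (f : OneSided n ≃ OneSided n) :
    permOp f * star (permOp f) = 1 := by
  rw [star_permOp, permOp_mul, Equiv.symm_trans_self, permOp_refl]

theorem star_mul_permOp {n : ℕ} (f : OneSided n ≃ OneSided n) :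
    star (permOp f) * permOp f = 1 := by
  rw [star_permOp, permOp_mul, Equiv.self_trans_symm, permOp_refl]

/-! ### Words in permutative isometries -/

/-- The sequence `μ x`. -/
def cat {n : ℕ} (μ : List (Fin n)) (x : OneSided n) : OneSided n := μ.foldr prepend x

/-- The word `μ` is an initial segment of `x`. -/
def IsPrefix {n : ℕ} : List (Fin n) → OneSided n → Prop
  | [], _ => True
  | i :: μ, x => i = x 0 ∧ IsPrefix μ (drop 1 x)

theorem isPrefix_iff {n : ℕ} (μ : List (Fin n)) (x : OneSided n) :
    IsPrefix μ x ↔ ∀ k (h : k < μ.length), μ[k] = x k := by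
  induction μ generalizing x with
  | nil => simp [IsPrefix]
  | cons i μ ih =>
    rw [IsPrefix, ih]
    constructor
    · rintro ⟨h0, h⟩ k hk
      cases k with
      | zero => exact h0
      | succ k => exact h k (by simpa using hk)
    · intro h
      exact ⟨h 0 (by simp), fun k hk => h (k + 1) (by simpa using hk)⟩

theorem isPrefix_ofFn {n m : ℕ} (w : Fin m → Fin n) (x : OneSided n) :
    IsPrefix (List.ofFn w) x ↔ w = fun k : Fin m => x k := by
  rw [isPrefix_iff]
  simp only [List.length_ofFn, List.getElem_ofFn]
  exact ⟨fun h => funext fun k => h k k.2, fun h k hk => congrFun h ⟨k, hk⟩⟩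

theorem cat_apply {n : ℕ} (μ : List (Fin n)) (x : OneSided n) (k : ℕ) :
    cat μ x k = if h : k < μ.length then μ[k] else x (k - μ.length) := by
  induction μ generalizing k with
  | nil => simp [cat]
  | cons i μ ih =>
    change prepend i (cat μ x) k = _
    cases k with
    | zero => simp
    | succ k =>
      change cat μ x k = _
      rw [ih]
      simp

theorem drop_cat {n : ℕ} (μ : List (Fin n)) (x : OneSided n) : drop μ.length (cat μ x) = x := by
  funext k
  simp [drop_apply, cat_apply]

theorem continuous_cat {n : ℕ} (μ : List (Fin n)) : Continuous (cat (n := n) μ) := by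
  refine continuous_pi fun k => ?_
  simp only [cat_apply]
  split_ifs
  · exact continuous_const
  · exact continuous_apply _

theorem isOpen_isPrefix {n : ℕ} (μ : List (Fin n)) : IsOpen {x : OneSided n | IsPrefix μ x} := by
  induction μ with
  | nil => simp [IsPrefix]
  | cons i μ ih =>
    exact ((isOpen_discrete {y : Fin n | i = y}).preimage (continuous_apply 0)).inter
      (ih.preimage (continuous_drop 1))

/-- The dynamics `σ ∘ τ⁻¹` on `X_n`. -/
def step {n : ℕ} (τ : OneSided n ≃ OneSided n) (y : OneSided n) : OneSided n :=
  drop 1 (τ.symm y)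

/-- The itinerary of `y` under `step τ`, read through the first coordinate of `τ⁻¹`. -/
def itin {n : ℕ} (τ : OneSided n ≃ OneSided n) (y : OneSided n) : OneSided n :=
  fun k => τ.symm ((step τ)^[k] y) 0

theorem step_apply_prepend {n : ℕ} (τ : OneSided n ≃ OneSided n) (i : Fin n) (y : OneSided n) :
    step τ (τ (prepend i y)) = y := by
  simp [step]

theorem itin_step {n : ℕ} (τ : OneSided n ≃ OneSided n) (y : OneSided n) :
    itin τ (step τ y) = drop 1 (itin τ y) := by
  funext k
  rfl

theorem itin_iterate_step {n : ℕ} (τ : OneSided n ≃ OneSided n) (m : ℕ) (y : OneSided n) :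
    itin τ ((step τ)^[m] y) = drop m (itin τ y) := by
  induction m with
  | zero => rfl
  | succ m ih => rw [Function.iterate_succ_apply', itin_step, ih, drop_drop, add_comm]

theorem apply_prepend_step {n : ℕ} (τ : OneSided n ≃ OneSided n) (y : OneSided n) :
    τ (prepend (itin τ y 0) (step τ y)) = y := by
  change τ (prepend (τ.symm y 0) (drop 1 (τ.symm y))) = y
  rw [prepend_drop_one, τ.apply_symm_apply]

/-- This intertwining makes the inverse of `itin τ`, once it exists, conjugate `isomOp i` to `permOp
τ * isomOp i`. -/
theorem itin_apply_prepend {n : ℕ} (τ : OneSided n ≃ OneSided n) (i : Fin n) (y : OneSided n) :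
    itin τ (τ (prepend i y)) = prepend i (itin τ y) := by
  rw [← prepend_drop_one (itin τ (τ (prepend i y))), ← itin_step, step_apply_prepend]
  simp [itin]

theorem step_refl {n : ℕ} : step (Equiv.refl (OneSided n)) = drop 1 := rfl

theorem itin_refl {n : ℕ} (x : OneSided n) : itin (Equiv.refl _) x = x := by
  funext k
  simp only [itin, step_refl, iterate_drop_one, Equiv.refl_symm, Equiv.refl_apply, drop_apply,
    zero_add]

/-- The product of the isometries `e_y ↦ e_{τ(i y)}` along the word `μ`. -/
def wordOp {n : ℕ} (τ : OneSided n ≃ OneSided n) (μ : List (Fin n)) : Hilb n →L[ℂ] Hilb n :=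
  (μ.map fun i => permOp τ * isomOp i).prod

theorem star_permOp_mul_isomOp_basisVec {n : ℕ} (τ : OneSided n ≃ OneSided n) (i : Fin n)
    (y : OneSided n) : star (permOp τ * isomOp i) (basisVec y) =
      if i = itin τ y 0 then basisVec (step τ y) else 0 := by
  rw [star_mul, star_permOp, mul_apply_eq_comp, permOp_basisVec, ← prepend_drop_one (τ.symm y),
    star_isomOp_basisVec]
  rfl

theorem star_wordOp_basisVec {n : ℕ} (τ : OneSided n ≃ OneSided n) (μ : List (Fin n))
    (y : OneSided n) : star (wordOp τ μ) (basisVec y) =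
      if IsPrefix μ (itin τ y) then basisVec ((step τ)^[μ.length] y) else 0 := by
  induction μ generalizing y with
  | nil => simp [wordOp, IsPrefix]
  | cons i μ ih =>
    have : wordOp τ (i :: μ) = (permOp τ * isomOp i) * wordOp τ μ := by simp [wordOp]
    rw [this, star_mul, mul_apply_eq_comp, star_permOp_mul_isomOp_basisVec]
    by_cases h : i = itin τ y 0
    · simp [h, ih, IsPrefix, itin_step]
    · simp [h, IsPrefix]

/-- The coefficient is the inner product of two vectors each of which is `0` or a basis vector. It
sees the points only through their itineraries and the coincidences between their orbits. -/
theorem wordOp_mul_star_coeff {n : ℕ} (τ : OneSided n ≃ OneSided n) (μ ν : List (Fin n))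
    (y y' : OneSided n) : (wordOp τ μ * star (wordOp τ ν)) (basisVec y) y' =
      if IsPrefix μ (itin τ y') ∧ IsPrefix ν (itin τ y) ∧
        (step τ)^[μ.length] y' = (step τ)^[ν.length] y then 1 else 0 := by
  rw [mul_coeff, star_wordOp_basisVec, star_wordOp_basisVec]
  by_cases h1 : IsPrefix μ (itin τ y') <;> by_cases h2 : IsPrefix ν (itin τ y) <;>
    simp [h1, h2, inner_basisVec]

theorem coe_word {n : ℕ} (μ : List (Fin n)) :
    ((word μ : On n) : Hilb n →L[ℂ] Hilb n) = wordOp (Equiv.refl _) μ := by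
  induction μ with
  | nil => simp [word, wordOp]
  | cons i μ ih =>
    have h1 : word (i :: μ) = S i * word μ := by simp [word]
    have h2 : wordOp (Equiv.refl _) (i :: μ) = isomOp i * wordOp (Equiv.refl _) μ := by
      simp [wordOp, permOp_refl]
    rw [h1, h2, ← ih]
    rfl

theorem word_basisVec {n : ℕ} (μ : List (Fin n)) (x : OneSided n) :
    ((word μ : On n) : Hilb n →L[ℂ] Hilb n) (basisVec x) = basisVec (cat μ x) := by
  induction μ with
  | nil => simp [word, cat]
  | cons i μ ih =>
    have h1 : word (i :: μ) = S i * word μ := by simp [word]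
    rw [h1]
    change isomOp i (((word μ : On n) : Hilb n →L[ℂ] Hilb n) (basisVec x)) = _
    rw [ih, isomOp_basisVec]
    rfl

theorem star_word_basisVec {n : ℕ} (ν : List (Fin n)) (x : OneSided n) :
    ((star (word ν) : On n) : Hilb n →L[ℂ] Hilb n) (basisVec x) =
      if IsPrefix ν x then basisVec (drop ν.length x) else 0 := by
  change star ((word ν : On n) : Hilb n →L[ℂ] Hilb n) (basisVec x) = _
  rw [coe_word, star_wordOp_basisVec, itin_refl, step_refl, iterate_drop_one]

theorem word_mul_star_basisVec {n : ℕ} (μ ν : List (Fin n)) (x : OneSided n) :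
    ((word μ * star (word ν) : On n) : Hilb n →L[ℂ] Hilb n) (basisVec x) =
      if IsPrefix ν x then basisVec (cat μ (drop ν.length x)) else 0 := by
  change ((word μ : On n) : Hilb n →L[ℂ] Hilb n)
    (((star (word ν) : On n) : Hilb n →L[ℂ] Hilb n) (basisVec x)) = _
  rw [star_word_basisVec]
  split_ifs
  · rw [word_basisVec]
  · simp

/-! ### The Cuntz algebra as a closed span -/

instance isClosed_algebra (n : ℕ) : IsClosed (algebra n : Set (Hilb n →L[ℂ] Hilb n)) :=
  StarSubalgebra.isClosed_topologicalClosure _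

theorem continuous_starAlgEquiv {n : ℕ} (α : On n ≃⋆ₐ[ℂ] On n) : Continuous α :=
  (StarAlgEquiv.isometry α).continuous

/-- The linear span of the `S_μ S_ν⋆`. -/
def wordSpan (n : ℕ) : Submodule ℂ (On n) :=
  Submodule.span ℂ {a | ∃ μ ν : List (Fin n), a = word μ * star (word ν)}

theorem word_mul_star_mem_wordSpan {n : ℕ} (μ ν : List (Fin n)) :
    word μ * star (word ν) ∈ wordSpan n :=
  Submodule.subset_span ⟨μ, ν, rfl⟩

theorem star_S_mul_S_eq {n : ℕ} (i j : Fin n) :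
    star (S i) * S j = if i = j then (1 : On n) else 0 := by
  apply Subtype.ext
  have h := star_isomOp_mul i j
  split_ifs with hij
  · rw [if_pos hij] at h; exact h
  · rw [if_neg hij] at h; exact h

theorem word_cons {n : ℕ} (i : Fin n) (μ : List (Fin n)) : word (i :: μ) = S i * word μ := by
  simp [word]

theorem S_mul_mem_wordSpan {n : ℕ} (i : Fin n) {m : On n} (hm : m ∈ wordSpan n) :
    S i * m ∈ wordSpan n ∧ star (S i) * m ∈ wordSpan n := by
  refine Submodule.span_induction ?_ ?_ ?_ ?_ hm
  · rintro _ ⟨μ, ν, rfl⟩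
    refine ⟨?_, ?_⟩
    · rw [← mul_assoc, ← word_cons]
      exact word_mul_star_mem_wordSpan _ _
    · cases μ with
      | nil =>
        have : star (S i) * (word [] * star (word ν)) = word [] * star (word (ν ++ [i])) := by
          simp [word]
        rw [this]
        exact word_mul_star_mem_wordSpan _ _
      | cons j μ =>
        rw [word_cons, ← mul_assoc, ← mul_assoc, star_S_mul_S_eq]
        split_ifs
        · rw [one_mul]
          exact word_mul_star_mem_wordSpan _ _
        · simp
  · simp
  · intro a b _ _ ha hb
    rw [mul_add, mul_add]
    exact ⟨add_mem ha.1 hb.1, add_mem ha.2 hb.2⟩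
  · intro c a _ ha
    rw [mul_smul_comm, mul_smul_comm]
    exact ⟨Submodule.smul_mem _ _ ha.1, Submodule.smul_mem _ _ ha.2⟩

/-- The induction carries the stronger statement that left multiplication by the element and by its
adjoint preserves `wordSpan n`. This is stable under products and stars without multiplying two
general words; applying it to `1` gives membership. -/
theorem exists_wordSpan_of_mem_adjoin {n : ℕ} {b : Hilb n →L[ℂ] Hilb n}
    (hb : b ∈ StarAlgebra.adjoin ℂ (Set.range (isomOp (n := n)))) :
    ∃ c ∈ wordSpan n, (c : Hilb n →L[ℂ] Hilb n) = b := by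
  have key : ∃ c : On n, (c : Hilb n →L[ℂ] Hilb n) = b ∧
      ∀ m ∈ wordSpan n, c * m ∈ wordSpan n ∧ star c * m ∈ wordSpan n := by
    induction hb using StarAlgebra.adjoin_induction with
    | mem x hx =>
      obtain ⟨i, rfl⟩ := hx
      exact ⟨S i, rfl, fun m hm => S_mul_mem_wordSpan i hm⟩
    | algebraMap r =>
      refine ⟨algebraMap ℂ (On n) r, rfl, fun m hm => ?_⟩
      rw [← algebraMap_star_comm, ← Algebra.smul_def, ← Algebra.smul_def]
      exact ⟨Submodule.smul_mem _ _ hm, Submodule.smul_mem _ _ hm⟩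
    | add x y hx hy ihx ihy =>
      obtain ⟨c, rfl, hc⟩ := ihx
      obtain ⟨d, rfl, hd⟩ := ihy
      refine ⟨c + d, rfl, fun m hm => ?_⟩
      rw [star_add, add_mul, add_mul]
      exact ⟨add_mem (hc m hm).1 (hd m hm).1, add_mem (hc m hm).2 (hd m hm).2⟩
    | mul x y hx hy ihx ihy =>
      obtain ⟨c, rfl, hc⟩ := ihx
      obtain ⟨d, rfl, hd⟩ := ihy
      refine ⟨c * d, rfl, fun m hm => ?_⟩
      rw [star_mul, mul_assoc, mul_assoc]
      exact ⟨(hc _ (hd m hm).1).1, (hd _ (hc m hm).2).2⟩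
    | star x hx ih =>
      obtain ⟨c, rfl, hc⟩ := ih
      refine ⟨star c, rfl, fun m hm => ?_⟩
      rw [star_star]
      exact (hc m hm).symm
  obtain ⟨c, hcb, hc⟩ := key
  have h1 : (1 : On n) ∈ wordSpan n := by
    have := word_mul_star_mem_wordSpan (n := n) [] []
    simpa [word] using this
  exact ⟨c, by simpa using (hc 1 h1).1, hcb⟩

theorem dense_wordSpan (n : ℕ) : Dense (wordSpan n : Set (On n)) := by
  intro a
  rw [Metric.mem_closure_iff]
  intro ε hε
  have ha : (a : Hilb n →L[ℂ] Hilb n) ∈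
      closure (StarAlgebra.adjoin ℂ (Set.range (isomOp (n := n))) : Set _) := a.2
  obtain ⟨b, hb, hab⟩ := Metric.mem_closure_iff.mp ha ε hε
  obtain ⟨c, hc, rfl⟩ := exists_wordSpan_of_mem_adjoin hb
  exact ⟨c, hc, hab⟩

end

end Cuntz

namespace Cuntz

noncomputable section

open scoped Classical

/-! ### Permutation unitaries are the permutation operators of local homeomorphisms -/

/-- Inner products of basis vectors are `0` or `1`, so nothing cancels and the squared norm is at
least the number of terms. Hence at each basis vector exactly one word of a unitary sum is active.
-/
theorem card_eq_one_of_norm_sum_basisVec {n : ℕ} {ι : Type*} (s : Finset ι)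
    (y : ι → OneSided n) (h : ‖∑ j ∈ s, (basisVec (y j) : Hilb n)‖ = 1) : s.card = 1 := by
  have h1 : inner ℂ (∑ j ∈ s, (basisVec (y j) : Hilb n)) (∑ j ∈ s, basisVec (y j)) =
      ((∑ j ∈ s, (s.filter fun k => y j = y k).card : ℕ) : ℂ) := by
    simp only [sum_inner, inner_sum, inner_basisVec]
    push_cast
    exact Finset.sum_congr rfl fun j _ => by simp [eq_comm]
  rw [inner_self_eq_norm_sq_to_K, h] at h1
  have h2 : ∑ j ∈ s, (s.filter fun k => y j = y k).card = 1 := by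
    apply Nat.cast_injective (R := ℂ)
    rw [← h1]
    simp
  have h3 : s.card ≤ ∑ j ∈ s, (s.filter fun k => y j = y k).card := by
    rw [Finset.card_eq_sum_ones]
    refine Finset.sum_le_sum fun j hj => ?_
    exact Finset.card_pos.mpr ⟨j, by simp [hj]⟩
  have h4 : s.card ≠ 0 := by
    intro h0
    rw [Finset.card_eq_zero] at h0
    simp [h0] at h2
  omega

theorem star_mem_wordUnitaries {n : ℕ} {u : On n} (hu : u ∈ wordUnitaries n) :
    star u ∈ wordUnitaries n := by
  obtain ⟨hu, m, μ, ν, rfl⟩ := hu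
  exact ⟨Unitary.star_mem hu, m, ν, μ, by simp⟩

theorem norm_unitary_basisVec {n : ℕ} {u : On n} (hu : u ∈ unitary (On n)) (x : OneSided n) :
    ‖(u : Hilb n →L[ℂ] Hilb n) (basisVec x)‖ = 1 := by
  have h1 : star (u : Hilb n →L[ℂ] Hilb n) * u = 1 :=
    congrArg Subtype.val (Unitary.star_mul_self_of_mem hu)
  have h2 : inner ℂ ((u : Hilb n →L[ℂ] Hilb n) (basisVec x))
      ((u : Hilb n →L[ℂ] Hilb n) (basisVec x)) = 1 := by
    rw [← ContinuousLinearMap.adjoint_inner_right, ← ContinuousLinearMap.star_eq_adjoint,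
      ← mul_apply_eq_comp, h1]
    simp [norm_basisVec]
  rw [inner_self_eq_norm_sq_to_K] at h2
  have h3 : ‖(u : Hilb n →L[ℂ] Hilb n) (basisVec x)‖ ^ 2 = 1 := by
    have h4 : ((‖(u : Hilb n →L[ℂ] Hilb n) (basisVec x)‖ ^ 2 : ℝ) : ℂ) = 1 := by
      push_cast; exact h2
    exact_mod_cast h4
  have h5 := norm_nonneg ((u : Hilb n →L[ℂ] Hilb n) (basisVec x))
  nlinarith

theorem exists_continuous_of_mem_wordUnitaries {n : ℕ} {u : On n} (hu : u ∈ wordUnitaries n) :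
    ∃ φ : OneSided n → OneSided n, Continuous φ ∧
      ∀ x, (u : Hilb n →L[ℂ] Hilb n) (basisVec x) = basisVec (φ x) := by
  obtain ⟨hu, m, μ, ν, hsum⟩ := hu
  have happ : ∀ x, (u : Hilb n →L[ℂ] Hilb n) (basisVec x) =
      ∑ j ∈ Finset.univ.filter (fun j => IsPrefix (ν j) x),
        basisVec (cat (μ j) (drop (ν j).length x)) := by
    intro x
    rw [hsum, Finset.sum_filter, AddSubmonoidClass.coe_finsetSum, sum_apply]
    exact Finset.sum_congr rfl fun j _ => word_mul_star_basisVec _ _ _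
  have hex : ∀ x, ∃ j, Finset.univ.filter (fun j => IsPrefix (ν j) x) = {j} := by
    intro x
    have h := norm_unitary_basisVec hu x
    rw [happ] at h
    exact Finset.card_eq_one.mp (card_eq_one_of_norm_sum_basisVec _ _ h)
  choose j hj using hex
  refine ⟨fun x => cat (μ (j x)) (drop (ν (j x)).length x), ?_, fun x => ?_⟩
  · rw [continuous_iff_continuousAt]
    intro x
    have hx : IsPrefix (ν (j x)) x := by
      have : j x ∈ Finset.univ.filter (fun j => IsPrefix (ν j) x) := by rw [hj x]; simp
      simpa using this
    have hc : ContinuousAt (fun y => cat (μ (j x)) (drop (ν (j x)).length y)) x :=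
      ((continuous_cat _).comp (continuous_drop _)).continuousAt
    refine hc.congr ?_
    -- On the cylinder of `ν (j x)` the word `j x` is active, hence it is the only one: `j` is
    -- locally constant.
    filter_upwards [(isOpen_isPrefix (ν (j x))).mem_nhds hx] with y hy
    have : j x ∈ Finset.univ.filter (fun j => IsPrefix (ν j) y) := by simpa using hy
    rw [hj y, Finset.mem_singleton] at this
    rw [this]
  · rw [happ, hj x, Finset.sum_singleton]

theorem exists_homeomorph_of_mem_wordUnitaries {n : ℕ} {u : On n} (hu : u ∈ wordUnitaries n) :
    ∃ f : OneSided n ≃ₜ OneSided n, (u : Hilb n →L[ℂ] Hilb n) = permOp f.toEquiv := by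
  obtain ⟨φ, hφ, hφu⟩ := exists_continuous_of_mem_wordUnitaries hu
  obtain ⟨ψ, hψ, hψu⟩ := exists_continuous_of_mem_wordUnitaries (star_mem_wordUnitaries hu)
  have h1 : ((star u : On n) : Hilb n →L[ℂ] Hilb n) * u = 1 :=
    congrArg Subtype.val (Unitary.star_mul_self_of_mem hu.1)
  have h2 : (u : Hilb n →L[ℂ] Hilb n) * ((star u : On n) : Hilb n →L[ℂ] Hilb n) = 1 :=
    congrArg Subtype.val (Unitary.mul_star_self_of_mem hu.1)
  refine ⟨⟨⟨φ, ψ, fun x => ?_, fun x => ?_⟩, hφ, hψ⟩, ext_basisVec fun x => ?_⟩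
  · apply basisVec_injective
    rw [← hψu, ← hφu, ← mul_apply_eq_comp, h1]
    rfl
  · apply basisVec_injective
    rw [← hφu, ← hψu, ← mul_apply_eq_comp, h2]
    rfl
  · rw [hφu, permOp_basisVec]
    rfl

/-- The matrix coefficients of `a` vanish off the pairs of sequences that agree from `m` on. -/
def IsBanded {n : ℕ} (m : ℕ) (a : Hilb n →L[ℂ] Hilb n) : Prop :=
  ∀ x y, a (basisVec x) y ≠ 0 → drop m y = drop m x

theorem IsBanded.mono {n m m' : ℕ} (h : m ≤ m') {a : Hilb n →L[ℂ] Hilb n} (ha : IsBanded m a) :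
    IsBanded m' a :=
  fun x y hxy => drop_eq_of_le h (ha x y hxy)

/-- Having equal tails from some coordinate on is an equivalence relation. This gives stability
under products, through an intermediate index, and under adjoints. -/
theorem exists_isBanded_of_mem_adjoin {n : ℕ} {a : On n}
    (ha : a ∈ StarAlgebra.adjoin ℂ {a : On n | ∃ μ ν : List (Fin n),
      μ.length = ν.length ∧ a = word μ * star (word ν)}) :
    ∃ m, IsBanded m (a : Hilb n →L[ℂ] Hilb n) := by
  induction ha using StarAlgebra.adjoin_induction with
  | mem a h =>
    obtain ⟨μ, ν, hl, rfl⟩ := h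
    refine ⟨μ.length, fun x y hxy => ?_⟩
    rw [word_mul_star_basisVec] at hxy
    by_cases hp : IsPrefix ν x
    · rw [if_pos hp, basisVec_apply] at hxy
      have : y = cat μ (drop ν.length x) := by
        by_contra hne
        simp [hne] at hxy
      rw [this, drop_cat, hl]
    · simp [hp] at hxy
  | algebraMap r =>
    refine ⟨0, fun x y hxy => ?_⟩
    have h1 : ((algebraMap ℂ (On n) r : On n) : Hilb n →L[ℂ] Hilb n) (basisVec x) =
      r • basisVec x := rfl
    rw [h1] at hxy
    by_contra hne
    have h2 : y ≠ x := fun h => hne (by rw [h])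
    simp [basisVec_apply, h2] at hxy
  | add a b _ _ iha ihb =>
    obtain ⟨p, hp⟩ := iha
    obtain ⟨q, hq⟩ := ihb
    refine ⟨max p q, fun x y hxy => ?_⟩
    by_cases h : (a : Hilb n →L[ℂ] Hilb n) (basisVec x) y = 0
    · refine hq.mono (le_max_right p q) x y fun h' => hxy ?_
      have h3 : ((a + b : On n) : Hilb n →L[ℂ] Hilb n) (basisVec x) y =
        (a : Hilb n →L[ℂ] Hilb n) (basisVec x) y + (b : Hilb n →L[ℂ] Hilb n) (basisVec x) y := rfl
      rw [h3, h, h', add_zero]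
    · exact hp.mono (le_max_left p q) x y h
  | mul a b _ _ iha ihb =>
    obtain ⟨p, hp⟩ := iha
    obtain ⟨q, hq⟩ := ihb
    refine ⟨max p q, fun x y hxy => ?_⟩
    have h3 : ((a * b : On n) : Hilb n →L[ℂ] Hilb n) =
      (a : Hilb n →L[ℂ] Hilb n) * (b : Hilb n →L[ℂ] Hilb n) := rfl
    rw [h3, mul_coeff] at hxy
    obtain ⟨z, hz1, hz2⟩ := exists_of_inner_ne_zero hxy
    rw [star_coeff] at hz1
    have hz3 : (a : Hilb n →L[ℂ] Hilb n) (basisVec z) y ≠ 0 := fun h => hz1 (by rw [h, map_zero])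
    rw [hp.mono (le_max_left p q) z y hz3, hq.mono (le_max_right p q) x z hz2]
  | star a _ ih =>
    obtain ⟨p, hp⟩ := ih
    refine ⟨p, fun x y hxy => ?_⟩
    have h3 : ((star a : On n) : Hilb n →L[ℂ] Hilb n) = star (a : Hilb n →L[ℂ] Hilb n) := rfl
    rw [h3, star_coeff] at hxy
    exact (hp y x fun h => hxy (by rw [h, map_zero])).symm

/-- An operator close to a permutation operator has non-zero coefficients along the permutation. -/
theorem coeff_ne_zero_of_norm_sub_lt {n : ℕ} {f : OneSided n ≃ OneSided n}
    {a : Hilb n →L[ℂ] Hilb n} (h : ‖permOp f - a‖ < 1) (x : OneSided n) :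
    a (basisVec x) (f x) ≠ 0 := by
  intro h0
  have h1 := norm_coeff_le (permOp f - a) x (f x)
  have h2 : (permOp f - a) (basisVec x) (f x) = 1 := by
    have : (permOp f - a) (basisVec x) (f x) =
      permOp f (basisVec x) (f x) - a (basisVec x) (f x) := rfl
    rw [this, h0, permOp_basisVec, basisVec_apply]
    simp
  rw [h2, norm_one] at h1
  linarith

/-- A banded element at distance less than `1` has a non-zero coefficient at every pair `(x, f x)`,
so its band width is a uniform bound for `f`. -/
theorem exists_isLocal_of_mem_permUnitaries {n : ℕ} {u : On n} (hu : u ∈ permUnitaries n) :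
    ∃ f : OneSided n ≃ₜ OneSided n, IsLocal f ∧ (u : Hilb n →L[ℂ] Hilb n) = permOp f.toEquiv := by
  obtain ⟨f, hf⟩ := exists_homeomorph_of_mem_wordUnitaries hu.1
  refine ⟨f, ?_, hf⟩
  have hc : u ∈ closure (StarAlgebra.adjoin ℂ {a : On n | ∃ μ ν : List (Fin n),
      μ.length = ν.length ∧ a = word μ * star (word ν)} : Set (On n)) := hu.2
  obtain ⟨a, ha, hua⟩ := Metric.mem_closure_iff.mp hc 1 one_pos
  obtain ⟨m, hm⟩ := exists_isBanded_of_mem_adjoin ha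
  refine ⟨m, fun x => hm x (f x) ?_⟩
  have hd : ‖permOp f.toEquiv - (a : Hilb n →L[ℂ] Hilb n)‖ < 1 := by
    rw [← hf, ← dist_eq_norm]
    exact hua
  exact coeff_ne_zero_of_norm_sub_lt hd x

theorem isLocal_prefix_formula {n : ℕ} {f : OneSided n ≃ₜ OneSided n} (hf : IsLocal f) :
    ∃ K : ℕ, (∀ x, drop K (f x) = drop K x) ∧
      ∀ x y, (∀ i < K, x i = y i) → ∀ i < K, f x i = f y i := by
  obtain ⟨m, hm⟩ := hf
  have hc : Continuous fun x : OneSided n => fun i : Fin m => f x i :=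
    continuous_pi fun i => (continuous_apply (i : ℕ)).comp f.continuous
  obtain ⟨M, hM⟩ := exists_prefix_dependence hc
  refine ⟨max m M, fun x => drop_eq_of_le (le_max_left m M) (hm x), fun x y hxy i hi => ?_⟩
  by_cases him : i < m
  · exact congrFun (hM x y fun j hj => hxy j (lt_max_of_lt_right hj)) ⟨i, him⟩
  · rw [apply_eq_of_drop_eq (hm x) (not_lt.mp him), apply_eq_of_drop_eq (hm y) (not_lt.mp him)]
    exact hxy i hi

theorem exists_permUnitary_of_isLocal {n : ℕ} (hn : 0 < n) {f : OneSided n ≃ₜ OneSided n}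
    (hf : IsLocal f) :
    ∃ u ∈ permUnitaries n, (u : Hilb n →L[ℂ] Hilb n) = permOp f.toEquiv := by
  obtain ⟨K, hK, hKp⟩ := isLocal_prefix_formula hf
  -- The padding letter is irrelevant: by `hKp` the first `K` letters of `f x` depend only on those
  -- of `x`.
  let ext : (Fin K → Fin n) → OneSided n := fun w k => if h : k < K then w ⟨k, h⟩ else ⟨0, hn⟩
  let F : (Fin K → Fin n) → (Fin K → Fin n) := fun w k => f (ext w) k
  let u : On n := ∑ w : Fin K → Fin n, word (List.ofFn (F w)) * star (word (List.ofFn w))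
  have huop : (u : Hilb n →L[ℂ] Hilb n) = permOp f.toEquiv := by
    apply ext_basisVec
    intro x
    simp only [u]
    rw [AddSubmonoidClass.coe_finsetSum, sum_apply]
    simp only [word_mul_star_basisVec, isPrefix_ofFn]
    rw [Finset.sum_eq_single (fun k : Fin K => x k) (fun w _ hw => if_neg hw) (by simp),
      if_pos rfl, permOp_basisVec]
    congr 1
    funext k
    rw [cat_apply]
    simp only [List.length_ofFn, List.getElem_ofFn]
    split_ifs with hk
    · refine hKp _ _ (fun i hi => ?_) k hk
      simp [ext, hi]
    · rw [drop_apply, Nat.sub_add_cancel (not_lt.mp hk)]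
      exact (apply_eq_of_drop_eq (hK x) (not_lt.mp hk)).symm
  refine ⟨u, ⟨⟨?_, ?_⟩, ?_⟩, huop⟩
  · rw [Unitary.mem_iff]
    refine ⟨Subtype.ext ?_, Subtype.ext ?_⟩
    · change star (u : Hilb n →L[ℂ] Hilb n) * u = 1
      rw [huop, star_mul_permOp]
    · change (u : Hilb n →L[ℂ] Hilb n) * star (u : Hilb n →L[ℂ] Hilb n) = 1
      rw [huop, permOp_mul_star]
  · let e := Fintype.equivFin (Fin K → Fin n)
    refine ⟨_, fun j => List.ofFn (F (e.symm j)), fun j => List.ofFn (e.symm j), ?_⟩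
    exact (Equiv.sum_comp e.symm
      (fun w => word (List.ofFn (F w)) * star (word (List.ofFn w)))).symm
  · refine StarSubalgebra.le_topologicalClosure _ (sum_mem fun w _ => ?_)
    exact StarAlgebra.subset_adjoin ℂ _ ⟨_, _, by simp, rfl⟩

end

end Cuntz

namespace Cuntz

noncomputable section

open scoped Classical

/-! ### Spatially implemented automorphisms -/

/-- The automorphism `α` is conjugation by the permutation operator of `f`. -/
def Implements {n : ℕ} (α : On n ≃⋆ₐ[ℂ] On n) (f : OneSided n ≃ₜ OneSided n) : Prop :=
  ∀ a : On n, (α a : Hilb n →L[ℂ] Hilb n) = permOp f.toEquiv * a * star (permOp f.toEquiv)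

theorem continuous_coeff {n : ℕ} (x y : OneSided n) :
    Continuous fun a : Hilb n →L[ℂ] Hilb n => a (basisVec x) y := by
  simp only [apply_eq_inner]
  exact continuous_const.inner (ContinuousLinearMap.apply ℂ (Hilb n) (basisVec x)).continuous

/-- Both sides are continuous ⋆-homomorphisms in `a`, and the span of the words is dense. -/
theorem implements_of_S {n : ℕ} {α : On n ≃⋆ₐ[ℂ] On n} {f : OneSided n ≃ₜ OneSided n}
    (h : ∀ i, (α (S i) : Hilb n →L[ℂ] Hilb n) =
      permOp f.toEquiv * isomOp i * star (permOp f.toEquiv)) : Implements α f := by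
  have hword : ∀ μ : List (Fin n), (α (word μ) : Hilb n →L[ℂ] Hilb n) =
      permOp f.toEquiv * (word μ : On n) * star (permOp f.toEquiv) := by
    intro μ
    induction μ with
    | nil =>
      have h1 : (word [] : On n) = 1 := by simp [word]
      have h2 : ((1 : On n) : Hilb n →L[ℂ] Hilb n) = 1 := rfl
      rw [h1, map_one, h2, mul_one, permOp_mul_star]
    | cons i μ ih =>
      have h2 : ∀ a b : On n, ((a * b : On n) : Hilb n →L[ℂ] Hilb n) = a * b := fun _ _ => rfl
      have h3 : ((S i : On n) : Hilb n →L[ℂ] Hilb n) = isomOp i := rfl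
      rw [word_cons, map_mul, h2, h2, h, ih, h3]
      simp only [mul_assoc]
      rw [← mul_assoc (star (permOp f.toEquiv)), star_mul_permOp, one_mul]
  have hspan : ∀ a ∈ wordSpan n, (α a : Hilb n →L[ℂ] Hilb n) =
      permOp f.toEquiv * a * star (permOp f.toEquiv) := by
    intro a ha
    induction ha using Submodule.span_induction with
    | mem a ha =>
      obtain ⟨μ, ν, rfl⟩ := ha
      have h2 : ∀ a b : On n, ((a * b : On n) : Hilb n →L[ℂ] Hilb n) = a * b := fun _ _ => rfl
      have h3 : ∀ a : On n, ((star a : On n) : Hilb n →L[ℂ] Hilb n) =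
        star (a : Hilb n →L[ℂ] Hilb n) := fun _ => rfl
      rw [map_mul, map_star, h2, h2, h3, h3, hword, hword, star_mul, star_mul, star_star]
      simp only [mul_assoc]
      rw [← mul_assoc (star (permOp f.toEquiv)) (permOp f.toEquiv), star_mul_permOp, one_mul]
    | zero =>
      have h2 : ((0 : On n) : Hilb n →L[ℂ] Hilb n) = 0 := rfl
      rw [map_zero, h2, mul_zero, zero_mul]
    | add a b _ _ iha ihb =>
      have h2 : ∀ a b : On n, ((a + b : On n) : Hilb n →L[ℂ] Hilb n) = a + b := fun _ _ => rfl
      rw [map_add, h2, h2, iha, ihb, mul_add, add_mul]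
    | smul c a _ ih =>
      have h2 : ∀ a : On n, ((c • a : On n) : Hilb n →L[ℂ] Hilb n) = c • (a : _) := fun _ => rfl
      rw [map_smul, h2, h2, ih, mul_smul_comm, smul_mul_assoc]
  have hcl : IsClosed {a : On n | (α a : Hilb n →L[ℂ] Hilb n) =
      permOp f.toEquiv * a * star (permOp f.toEquiv)} :=
    isClosed_eq (continuous_subtype_val.comp (continuous_starAlgEquiv α))
      ((continuous_const.mul continuous_subtype_val).mul continuous_const)
  intro a
  exact hcl.closure_subset_iff.mpr hspan (dense_wordSpan n a)

theorem Implements.coeff {n : ℕ} {α : On n ≃⋆ₐ[ℂ] On n} {f : OneSided n ≃ₜ OneSided n}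
    (h : Implements α f) (a : On n) (x y : OneSided n) :
    (α a : Hilb n →L[ℂ] Hilb n) (basisVec x) y =
      (a : Hilb n →L[ℂ] Hilb n) (basisVec (f.symm x)) (f.symm y) := by
  rw [h a, star_permOp, mul_assoc, mul_coeff, star_permOp, permOp_basisVec, mul_apply_eq_comp,
    permOp_basisVec, ← apply_eq_inner]
  rfl

theorem word_mul_star_self_coeff {n : ℕ} (μ : List (Fin n)) (x y : OneSided n) :
    ((word μ * star (word μ) : On n) : Hilb n →L[ℂ] Hilb n) (basisVec x) y =
      if IsPrefix μ x ∧ y = x then 1 else 0 := by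
  have h := wordOp_mul_star_coeff (Equiv.refl _) μ μ x y
  rw [← coe_word, itin_refl, itin_refl, step_refl, iterate_drop_one, iterate_drop_one] at h
  refine h.trans ?_
  congr 1
  rw [eq_iff_iff]
  constructor
  · rintro ⟨hy, hx, hd⟩
    refine ⟨hx, funext fun k => ?_⟩
    by_cases hk : k < μ.length
    · rw [← (isPrefix_iff μ y).mp hy k hk, ← (isPrefix_iff μ x).mp hx k hk]
    · exact apply_eq_of_drop_eq hd (not_lt.mp hk)
  · rintro ⟨hx, rfl⟩
    exact ⟨hx, hx, rfl⟩

/-- The vector states at basis vectors separate the points of `X_n`. -/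
theorem eq_of_diag_coeff_eq {n : ℕ} {x y : OneSided n}
    (h : ∀ a : On n, (a : Hilb n →L[ℂ] Hilb n) (basisVec x) x =
      (a : Hilb n →L[ℂ] Hilb n) (basisVec y) y) : x = y := by
  funext k
  have h1 := h (word (List.ofFn fun i : Fin (k + 1) => x i) *
    star (word (List.ofFn fun i : Fin (k + 1) => x i)))
  rw [word_mul_star_self_coeff, word_mul_star_self_coeff, isPrefix_ofFn, isPrefix_ofFn] at h1
  simp only [and_true, if_true] at h1
  by_contra hk
  rw [if_neg fun h => hk (congrFun h (Fin.last k))] at h1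
  exact one_ne_zero h1

/-- The vector state at `x` composed with `α` is the vector state at `f⁻¹(x)`, and distinct points
give distinct states. -/
theorem Implements.unique {n : ℕ} {α : On n ≃⋆ₐ[ℂ] On n} {f g : OneSided n ≃ₜ OneSided n}
    (hf : Implements α f) (hg : Implements α g) : f = g := by
  have h : ∀ x, f.symm x = g.symm x := fun x =>
    eq_of_diag_coeff_eq fun a => by rw [← hf.coeff, ← hg.coeff]
  ext1 x
  have h1 := h (f x)
  rw [f.symm_apply_apply] at h1
  exact (g.symm_apply_eq.mp h1.symm)

theorem Implements.mul {n : ℕ} {α β : On n ≃⋆ₐ[ℂ] On n} {f g : OneSided n ≃ₜ OneSided n}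
    (hf : Implements α f) (hg : Implements β g) : Implements (α * β) (f * g) := by
  intro a
  change (α (β a) : Hilb n →L[ℂ] Hilb n) = _
  have h1 : permOp (f * g).toEquiv = permOp f.toEquiv * permOp g.toEquiv := by
    rw [permOp_mul]; rfl
  rw [hf, hg, h1, star_mul]
  simp only [mul_assoc]

theorem Implements.eq {n : ℕ} {α β : On n ≃⋆ₐ[ℂ] On n} {f : OneSided n ≃ₜ OneSided n}
    (hf : Implements α f) (hg : Implements β f) : α = β := by
  ext1 a
  exact Subtype.ext ((hf a).trans (hg a).symm)

theorem permOp_cocycle_mul_isomOp {n : ℕ} (f : OneSided n ≃ₜ OneSided n) (i : Fin n) :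
    permOp f.toEquiv * isomOp i * star (permOp f.toEquiv) =
      permOp (cocycle f).toEquiv * isomOp i := by
  apply ext_basisVec
  intro x
  simp only [star_permOp, mul_apply_eq_comp, permOp_basisVec, isomOp_basisVec]
  rfl

theorem Implements.mem_weylSet {n : ℕ} (hn : 0 < n) {α : On n ≃⋆ₐ[ℂ] On n}
    {f : OneSided n ≃ₜ OneSided n} (h : Implements α f) (hf : EventuallyCommutes f) :
    α ∈ weylSet n := by
  obtain ⟨u, hu, hfu⟩ := exists_permUnitary_of_isLocal hn (isLocal_cocycle hf)
  refine ⟨u, hu, fun i => Subtype.ext ?_⟩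
  change (α (S i) : Hilb n →L[ℂ] Hilb n) = (u : Hilb n →L[ℂ] Hilb n) * isomOp i
  rw [h, hfu]
  exact permOp_cocycle_mul_isomOp f i

/-- It suffices to look at generators: `isomOp i` goes to `u S_i`, with `u` the permutation unitary
of `cocycle f`. -/
theorem conj_permOp_mem {n : ℕ} (hn : 0 < n) {f : OneSided n ≃ₜ OneSided n}
    (hf : EventuallyCommutes f) {a : Hilb n →L[ℂ] Hilb n} (ha : a ∈ algebra n) :
    permOp f.toEquiv * a * star (permOp f.toEquiv) ∈ algebra n := by
  let U : unitary (Hilb n →L[ℂ] Hilb n) :=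
    ⟨permOp f.toEquiv, Unitary.mem_iff.mpr ⟨star_mul_permOp _, permOp_mul_star _⟩⟩
  let φ : (Hilb n →L[ℂ] Hilb n) →⋆ₐ[ℂ] (Hilb n →L[ℂ] Hilb n) :=
    (Unitary.conjStarAlgAut ℂ _ U : (Hilb n →L[ℂ] Hilb n) ≃⋆ₐ[ℂ] (Hilb n →L[ℂ] Hilb n))
  have hφ : ∀ b, φ b = permOp f.toEquiv * b * star (permOp f.toEquiv) := fun b => rfl
  have hcont : Continuous φ := by
    have : (φ : (Hilb n →L[ℂ] Hilb n) → _) =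
      fun b => permOp f.toEquiv * b * star (permOp f.toEquiv) := funext hφ
    rw [this]
    exact (continuous_const.mul continuous_id).mul continuous_const
  have hle : algebra n ≤ (algebra n).comap φ := by
    refine StarSubalgebra.topologicalClosure_minimal (StarAlgebra.adjoin_le ?_)
      ((isClosed_algebra n).preimage hcont)
    rintro _ ⟨i, rfl⟩
    obtain ⟨u, hu, hfu⟩ := exists_permUnitary_of_isLocal hn (isLocal_cocycle hf)
    change φ (isomOp i) ∈ algebra n
    rw [hφ, permOp_cocycle_mul_isomOp, ← hfu]
    exact (u * S i).2
  exact hle ha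

theorem exists_implements {n : ℕ} (hn : 0 < n) {f : OneSided n ≃ₜ OneSided n}
    (hf : f ∈ commGroup n) : ∃ α : On n ≃⋆ₐ[ℂ] On n, Implements α f := by
  have h1 : star (permOp f.toEquiv) = permOp f.symm.toEquiv := star_permOp _
  have h2 : permOp f.symm.toEquiv * permOp f.toEquiv = 1 := by rw [← h1, star_mul_permOp]
  have h3 : permOp f.toEquiv * permOp f.symm.toEquiv = 1 := by rw [← h1, permOp_mul_star]
  have hs : star (permOp f.symm.toEquiv) = permOp f.toEquiv := by rw [← h1, star_star]
  have h4 : ∀ a, permOp f.symm.toEquiv * (permOp f.toEquiv * a) = a := fun a => by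
    rw [← mul_assoc, h2, one_mul]
  have h5 : ∀ a, permOp f.toEquiv * (permOp f.symm.toEquiv * a) = a := fun a => by
    rw [← mul_assoc, h3, one_mul]
  refine ⟨
    { toFun := fun a => ⟨permOp f.toEquiv * a * star (permOp f.toEquiv),
        conj_permOp_mem hn hf.1 a.2⟩
      invFun := fun a => ⟨permOp f.symm.toEquiv * a * star (permOp f.symm.toEquiv),
        conj_permOp_mem hn hf.2 a.2⟩
      left_inv := fun a => Subtype.ext ?_
      right_inv := fun a => Subtype.ext ?_
      map_mul' := fun a b => Subtype.ext ?_
      map_add' := fun a b => Subtype.ext ?_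
      map_star' := fun a => Subtype.ext ?_
      map_smul' := fun r a => Subtype.ext ?_ }, fun a => rfl⟩
  · simp only [h1, hs, mul_assoc, h2, h4, mul_one]
  · simp only [h1, hs, mul_assoc, h3, h5, mul_one]
  · change permOp f.toEquiv * ((a : Hilb n →L[ℂ] Hilb n) * b) * star (permOp f.toEquiv) =
      (permOp f.toEquiv * a * star (permOp f.toEquiv)) *
        (permOp f.toEquiv * b * star (permOp f.toEquiv))
    simp only [h1, mul_assoc, h4]
  · change permOp f.toEquiv * ((a : Hilb n →L[ℂ] Hilb n) + b) * star (permOp f.toEquiv) =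
      permOp f.toEquiv * a * star (permOp f.toEquiv) +
        permOp f.toEquiv * b * star (permOp f.toEquiv)
    rw [mul_add, add_mul]
  · change permOp f.toEquiv * star (a : Hilb n →L[ℂ] Hilb n) * star (permOp f.toEquiv) =
      star (permOp f.toEquiv * a * star (permOp f.toEquiv))
    simp only [star_mul, star_star, mul_assoc]
  · change permOp f.toEquiv * (r • (a : Hilb n →L[ℂ] Hilb n)) * star (permOp f.toEquiv) =
      r • (permOp f.toEquiv * a * star (permOp f.toEquiv))
    rw [mul_smul_comm, smul_mul_assoc]

theorem Implements.diagEval {n : ℕ} {α : On n ≃⋆ₐ[ℂ] On n} {f : OneSided n ≃ₜ OneSided n}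
    (h : Implements α f) (a : On n) (x : OneSided n) :
    diagEval x (α a) = Cuntz.diagEval (f.symm x) a := by
  simp only [Cuntz.diagEval, ← apply_eq_inner]
  exact h.coeff a x x

/-- The image is the indicator of the clopen set where `f⁻¹(x)` begins with `μ`. Membership there is
decided by finitely many letters of `x`, so the indicator is a finite sum of cylinder projections.
-/
theorem Implements.projection_mem_diagonal {n : ℕ} (hn : 0 < n) {α : On n ≃⋆ₐ[ℂ] On n}
    {f : OneSided n ≃ₜ OneSided n} (h : Implements α f) (μ : List (Fin n)) :
    α (word μ * star (word μ)) ∈ diagonal n := by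
  have hc : Continuous fun x : OneSided n => fun i : Fin μ.length => f.symm x i :=
    continuous_pi fun i => (continuous_apply (i : ℕ)).comp f.symm.continuous
  obtain ⟨M, hM⟩ := exists_prefix_dependence hc
  let ext : (Fin M → Fin n) → OneSided n := fun w k => if h : k < M then w ⟨k, h⟩ else ⟨0, hn⟩
  have hpre : ∀ x : OneSided n, IsPrefix μ (f.symm (ext fun k => x k)) ↔
      IsPrefix μ (f.symm x) := by
    intro x
    have h1 := hM (ext fun k => x k) x fun i hi => by simp [ext, hi]
    rw [isPrefix_iff, isPrefix_iff]
    exact forall₂_congr fun k hk => by rw [show f.symm (ext fun k => x k) k = f.symm x k from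
      congrFun h1 ⟨k, hk⟩]
  have hsum : α (word μ * star (word μ)) = ∑ w : Fin M → Fin n,
      if IsPrefix μ (f.symm (ext w)) then word (List.ofFn w) * star (word (List.ofFn w))
      else (0 : On n) := by
    apply Subtype.ext
    apply ext_basisVec
    intro x
    ext y
    rw [h.coeff, word_mul_star_self_coeff, AddSubmonoidClass.coe_finsetSum, sum_apply]
    rw [Finset.sum_eq_single (fun k : Fin M => x k)]
    · by_cases hp : IsPrefix μ (f.symm x)
      · rw [if_pos ((hpre x).mpr hp), word_mul_star_self_coeff, isPrefix_ofFn]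
        simp [hp]
      · rw [if_neg (fun h' => hp ((hpre x).mp h'))]
        simp [hp]
    · intro w _ hw
      split_ifs
      · rw [word_mul_star_basisVec, isPrefix_ofFn, if_neg hw]
      · rfl
    · simp
  rw [hsum]
  refine sum_mem fun w _ => ?_
  split_ifs
  · exact StarSubalgebra.le_topologicalClosure _ (StarAlgebra.subset_adjoin ℂ _ ⟨_, rfl⟩)
  · exact zero_mem _

theorem Implements.induces {n : ℕ} (hn : 0 < n) {α : On n ≃⋆ₐ[ℂ] On n}
    {f : OneSided n ≃ₜ OneSided n} (h : Implements α f) : Induces α f := by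
  intro a ha
  refine ⟨?_, h.diagEval a⟩
  have hle : diagonal n ≤ (diagonal n).comap (α : On n →⋆ₐ[ℂ] On n) := by
    refine StarSubalgebra.topologicalClosure_minimal (StarAlgebra.adjoin_le ?_)
      ((StarSubalgebra.isClosed_topologicalClosure _).preimage (continuous_starAlgEquiv α))
    rintro _ ⟨μ, rfl⟩
    exact h.projection_mem_diagonal hn μ
  exact hle ha

end

end Cuntz

namespace Cuntz

noncomputable section

open scoped Classical

/-! ### The homeomorphism behind an automorphism `λ_u` -/

theorem continuous_step {n : ℕ} (τ : OneSided n ≃ₜ OneSided n) : Continuous (step τ.toEquiv) :=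
  (continuous_drop 1).comp τ.symm.continuous

theorem continuous_itin {n : ℕ} (τ : OneSided n ≃ₜ OneSided n) : Continuous (itin τ.toEquiv) :=
  continuous_pi fun k => (continuous_apply 0).comp
    (τ.symm.continuous.comp ((continuous_step τ).iterate k))

theorem exists_itin_eq_of_lt {n : ℕ} (τ : OneSided n ≃ OneSided n) (k : ℕ) (x : OneSided n) :
    ∃ y, ∀ i < k, itin τ y i = x i := by
  induction k generalizing x with
  | zero => exact ⟨x, by simp⟩
  | succ k ih =>
    obtain ⟨y, hy⟩ := ih (drop 1 x)
    refine ⟨τ (prepend (x 0) y), fun i hi => ?_⟩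
    rw [itin_apply_prepend]
    cases i with
    | zero => rfl
    | succ i => exact hy i (by omega)

/-- The range is compact, and it is dense since every finite initial segment is realized. -/
theorem surjective_itin {n : ℕ} (τ : OneSided n ≃ₜ OneSided n) :
    Function.Surjective (itin τ.toEquiv) := by
  intro x
  have hcl : IsClosed (Set.range (itin τ.toEquiv)) :=
    (isCompact_range (continuous_itin τ)).isClosed
  choose y hy using fun k => exists_itin_eq_of_lt τ.toEquiv k x
  have ht : Filter.Tendsto (fun k => itin τ.toEquiv (y k)) Filter.atTop (nhds x) := by
    rw [tendsto_pi_nhds]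
    intro i
    refine tendsto_const_nhds.congr' ?_
    filter_upwards [Filter.eventually_gt_atTop i] with k hk
    exact (hy k i hk).symm
  exact hcl.mem_of_tendsto ht (Filter.Eventually.of_forall fun k => ⟨y k, rfl⟩)

theorem eq_of_step_eq_of_itin_eq {n : ℕ} (τ : OneSided n ≃ OneSided n) {y y' : OneSided n}
    (hi : itin τ y = itin τ y') (k : ℕ) (hs : (step τ)^[k] y = (step τ)^[k] y') : y = y' := by
  induction k generalizing y y' with
  | zero => exact hs
  | succ k ih =>
    have h1 : step τ y = step τ y' := by
      apply ih
      · rw [itin_step, itin_step, hi]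
      · exact hs
    rw [← apply_prepend_step τ y, ← apply_prepend_step τ y', h1, hi]

section Automorphism

variable {n : ℕ} {α : On n ≃⋆ₐ[ℂ] On n} {τ : OneSided n ≃ₜ OneSided n}

theorem coe_apply_word (hα : ∀ i, (α (S i) : Hilb n →L[ℂ] Hilb n) = permOp τ.toEquiv * isomOp i)
    (μ : List (Fin n)) : (α (word μ) : Hilb n →L[ℂ] Hilb n) = wordOp τ.toEquiv μ := by
  induction μ with
  | nil =>
    have h1 : (word [] : On n) = 1 := by simp [word]
    rw [h1, map_one]
    rfl
  | cons i μ ih =>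
    have h2 : wordOp τ.toEquiv (i :: μ) = (permOp τ.toEquiv * isomOp i) * wordOp τ.toEquiv μ := by
      simp [wordOp]
    rw [word_cons, map_mul, h2, ← ih, ← hα]
    rfl

theorem coeff_apply_word_mul_star
    (hα : ∀ i, (α (S i) : Hilb n →L[ℂ] Hilb n) = permOp τ.toEquiv * isomOp i)
    (μ ν : List (Fin n)) (y y' : OneSided n) :
    (α (word μ * star (word ν)) : Hilb n →L[ℂ] Hilb n) (basisVec y) y' =
      if IsPrefix μ (itin τ.toEquiv y') ∧ IsPrefix ν (itin τ.toEquiv y) ∧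
        (step τ.toEquiv)^[μ.length] y' = (step τ.toEquiv)^[ν.length] y then 1 else 0 := by
  rw [← wordOp_mul_star_coeff, ← coe_apply_word hα, ← coe_apply_word hα, map_mul, map_star]
  rfl

/-- Points with the same itinerary and the same periodicities of the orbit are equal, since `α` is
onto and cannot tell their vector states apart. -/
theorem eq_of_itin_eq_of_orbit_iff
    (hα : ∀ i, (α (S i) : Hilb n →L[ℂ] Hilb n) = permOp τ.toEquiv * isomOp i)
    {y y' : OneSided n} (hi : itin τ.toEquiv y = itin τ.toEquiv y')
    (ht : ∀ k l : ℕ, (step τ.toEquiv)^[k] y = (step τ.toEquiv)^[l] y ↔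
      (step τ.toEquiv)^[k] y' = (step τ.toEquiv)^[l] y') : y = y' := by
  have hspan : ∀ a ∈ wordSpan n, (α a : Hilb n →L[ℂ] Hilb n) (basisVec y) y =
      (α a : Hilb n →L[ℂ] Hilb n) (basisVec y') y' := by
    intro a ha
    induction ha using Submodule.span_induction with
    | mem a ha =>
      obtain ⟨μ, ν, rfl⟩ := ha
      rw [coeff_apply_word_mul_star hα, coeff_apply_word_mul_star hα, hi]
      simp only [ht]
    | zero => rw [map_zero]; rfl
    | add a b _ _ iha ihb =>
      rw [map_add]
      exact congrArg₂ (· + ·) iha ihb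
    | smul c a _ ih =>
      rw [map_smul]
      exact congrArg (c * ·) ih
  have hcl : IsClosed {a : On n | (α a : Hilb n →L[ℂ] Hilb n) (basisVec y) y =
      (α a : Hilb n →L[ℂ] Hilb n) (basisVec y') y'} :=
    isClosed_eq
      ((continuous_coeff y y).comp (continuous_subtype_val.comp (continuous_starAlgEquiv α)))
      ((continuous_coeff y' y').comp (continuous_subtype_val.comp (continuous_starAlgEquiv α)))
  refine eq_of_diag_coeff_eq fun a => ?_
  have h := hcl.closure_subset_iff.mpr hspan (dense_wordSpan n (α.symm a))
  simpa using h

theorem iterate_step_eq_of_drop_itin_eq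
    (hα : ∀ i, (α (S i) : Hilb n →L[ℂ] Hilb n) = permOp τ.toEquiv * isomOp i)
    {y : OneSided n} {p : ℕ} (hp : drop p (itin τ.toEquiv y) = itin τ.toEquiv y) :
    (step τ.toEquiv)^[p] y = y := by
  -- The points compared are `y` and its `p`-th iterate, which share an itinerary. A coincidence in
  -- the later orbit lifts back to `y` because the itineraries agree too.
  refine eq_of_itin_eq_of_orbit_iff hα ((itin_iterate_step _ p y).trans hp) fun k l => ?_
  rw [← Function.iterate_add_apply, ← Function.iterate_add_apply, add_comm k p, add_comm l p,
    Function.iterate_add_apply, Function.iterate_add_apply]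
  refine ⟨fun h => eq_of_step_eq_of_itin_eq _ ?_ p h, fun h => by rw [h]⟩
  have h1 := congrArg (itin τ.toEquiv) h
  rw [itin_iterate_step, itin_iterate_step, itin_iterate_step, itin_iterate_step, drop_drop,
    drop_drop, add_comm p k, add_comm p l, ← drop_drop, ← drop_drop, hp] at h1
  rw [itin_iterate_step, itin_iterate_step, h1]

theorem iterate_step_eq_iff
    (hα : ∀ i, (α (S i) : Hilb n →L[ℂ] Hilb n) = permOp τ.toEquiv * isomOp i)
    (y : OneSided n) (k l : ℕ) : (step τ.toEquiv)^[k] y = (step τ.toEquiv)^[l] y ↔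
      drop k (itin τ.toEquiv y) = drop l (itin τ.toEquiv y) := by
  refine ⟨fun h => by rw [← itin_iterate_step, h, itin_iterate_step], fun h => ?_⟩
  have aux : ∀ k c : ℕ, drop k (itin τ.toEquiv y) = drop (c + k) (itin τ.toEquiv y) →
      (step τ.toEquiv)^[k] y = (step τ.toEquiv)^[c + k] y := by
    intro k c hkc
    rw [Function.iterate_add_apply]
    refine (iterate_step_eq_of_drop_itin_eq hα ?_).symm
    rw [itin_iterate_step, drop_drop, hkc]
  rcases le_total k l with hkl | hkl
  · obtain ⟨c, rfl⟩ := Nat.exists_eq_add_of_le' hkl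
    exact aux k c h
  · obtain ⟨c, rfl⟩ := Nat.exists_eq_add_of_le' hkl
    exact (aux l c h.symm).symm

/-- Coincidences in an orbit are themselves determined by the itinerary, so equal itineraries leave
nothing for the vector states to distinguish. -/
theorem injective_itin
    (hα : ∀ i, (α (S i) : Hilb n →L[ℂ] Hilb n) = permOp τ.toEquiv * isomOp i) :
    Function.Injective (itin τ.toEquiv) := by
  intro y y' h
  refine eq_of_itin_eq_of_orbit_iff hα h fun k l => ?_
  rw [iterate_step_eq_iff hα, iterate_step_eq_iff hα, h]

theorem exists_orbit_bound
    (hα : ∀ i, (α (S i) : Hilb n →L[ℂ] Hilb n) = permOp τ.toEquiv * isomOp i)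
    {c : On n} (hc : c ∈ wordSpan n) :
    ∃ N : ℕ, ∀ y y', (α c : Hilb n →L[ℂ] Hilb n) (basisVec y) y' ≠ 0 →
      ∃ k ≤ N, ∃ l ≤ N, (step τ.toEquiv)^[k] y' = (step τ.toEquiv)^[l] y := by
  induction hc using Submodule.span_induction with
  | mem a ha =>
    obtain ⟨μ, ν, rfl⟩ := ha
    refine ⟨max μ.length ν.length, fun y y' h => ?_⟩
    rw [coeff_apply_word_mul_star hα] at h
    refine ⟨_, le_max_left _ _, _, le_max_right _ _, ?_⟩
    by_contra hne
    simp [hne] at h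
  | zero =>
    refine ⟨0, fun y y' h => absurd ?_ h⟩
    rw [map_zero]
    rfl
  | add a b _ _ iha ihb =>
    obtain ⟨p, hp⟩ := iha
    obtain ⟨q, hq⟩ := ihb
    refine ⟨max p q, fun y y' h => ?_⟩
    by_cases ha : (α a : Hilb n →L[ℂ] Hilb n) (basisVec y) y' = 0
    · by_cases hb : (α b : Hilb n →L[ℂ] Hilb n) (basisVec y) y' = 0
      · refine absurd ?_ h
        rw [map_add]
        exact (congrArg₂ (· + ·) ha hb).trans (add_zero 0)
      · obtain ⟨k, hk, l, hl, e⟩ := hq y y' hb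
        exact ⟨k, le_max_of_le_right hk, l, le_max_of_le_right hl, e⟩
    · obtain ⟨k, hk, l, hl, e⟩ := hp y y' ha
      exact ⟨k, le_max_of_le_left hk, l, le_max_of_le_left hl, e⟩
  | smul c a _ ih =>
    obtain ⟨p, hp⟩ := ih
    refine ⟨p, fun y y' h => hp y y' fun h0 => h ?_⟩
    rw [map_smul]
    exact (congrArg (c * ·) h0).trans (mul_zero c)

end Automorphism

/-- Since `τ⁻¹` does not touch coordinates from `L` on, `step τ` is the plain shift there. -/
theorem drop_iterate_step {n L : ℕ} {τ : OneSided n ≃ OneSided n}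
    (hL : ∀ x, drop L (τ.symm x) = drop L x) (k : ℕ) (y : OneSided n) :
    drop L ((step τ)^[k] y) = drop (L + k) y := by
  induction k with
  | zero => rfl
  | succ k ih =>
    rw [Function.iterate_succ_apply', step, drop_drop, add_comm L 1, ← drop_drop, hL, drop_drop,
      add_comm 1 L, add_comm L 1, ← drop_drop, ih, drop_drop]
    congr 1
    omega

/-- Sequences without short periods are dense. -/
theorem dense_aperiodic {n : ℕ} (hn : 2 ≤ n) (B : ℕ) :
    Dense {y : OneSided n | ∀ a ≤ B, ∀ b ≤ B, drop a y = drop b y → a = b} := by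
  intro y₀
  let y : ℕ → OneSided n := fun m k =>
    if k < m then y₀ k else if k < m + B then ⟨0, by omega⟩ else ⟨1, by omega⟩
  have ht : Filter.Tendsto y Filter.atTop (nhds y₀) := by
    rw [tendsto_pi_nhds]
    intro i
    refine tendsto_const_nhds.congr' ?_
    filter_upwards [Filter.eventually_gt_atTop i] with k hk
    simp [y, hk]
  refine mem_closure_of_tendsto ht (Filter.Eventually.of_forall fun m => ?_)
  have aux : ∀ a ≤ B, ∀ b ≤ B, a < b → drop a (y m) ≠ drop b (y m) := by
    intro a ha b hb hab h
    -- The block of `B` zeros is followed by ones only. This index reads the first one after the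
    -- shift by `b`, but still a zero after the smaller shift by `a`.
    have h1 := congrFun h (m + B - b)
    simp only [drop_apply, y] at h1
    rw [if_neg (by omega), if_pos (by omega), if_neg (by omega), if_neg (by omega)] at h1
    simp at h1
  intro a ha b hb h
  rcases lt_trichotomy a b with hab | hab | hab
  · exact absurd h (aux a ha b hb hab)
  · exact hab
  · exact absurd h.symm (aux b hb a ha hab)

/-- If `c` is a combination of words within `1` of `α⁻¹(u⋆)`, then `α(c)` has non-zero coefficients
along `τ⁻¹`, so the orbits of `y` and `τ⁻¹(y)` meet after boundedly many steps `k` and `l`. For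
aperiodic `y` the tails force `k = l`; density extends the resulting identity to all `y`, and
itineraries turn it into the claim. -/
theorem eventuallyCommutes_itin {n : ℕ} (hn : 2 ≤ n) {α : On n ≃⋆ₐ[ℂ] On n}
    {τ : OneSided n ≃ₜ OneSided n} (hτ : IsLocal τ) {u : On n}
    (hu : (u : Hilb n →L[ℂ] Hilb n) = permOp τ.toEquiv)
    (hα : ∀ i, (α (S i) : Hilb n →L[ℂ] Hilb n) = permOp τ.toEquiv * isomOp i) :
    EventuallyCommutes (itin τ.toEquiv) := by
  obtain ⟨L, hL⟩ := IsLocal.symm (f := τ.toEquiv) hτ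
  obtain ⟨c, hc, hd⟩ :=
    Metric.mem_closure_iff.mp (dense_wordSpan n (α.symm (star u))) 1 one_pos
  obtain ⟨N, hN⟩ := exists_orbit_bound hα hc
  have hdist : ‖permOp τ.toEquiv.symm - (α c : Hilb n →L[ℂ] Hilb n)‖ < 1 := by
    rw [← star_permOp, ← hu, ← dist_eq_norm]
    rw [← (StarAlgEquiv.isometry α).dist_eq, StarAlgEquiv.apply_symm_apply] at hd
    exact hd
  have hcl : IsClosed {y : OneSided n |
      (step τ.toEquiv)^[N] (τ.symm y) = (step τ.toEquiv)^[N] y} :=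
    isClosed_eq (((continuous_step τ).iterate N).comp τ.symm.continuous)
      ((continuous_step τ).iterate N)
  have hall : ∀ y, (step τ.toEquiv)^[N] (τ.symm y) = (step τ.toEquiv)^[N] y := by
    intro y
    refine hcl.closure_subset_iff.mpr ?_ (dense_aperiodic hn (L + N) y)
    intro y hy
    obtain ⟨k, hk, l, hl, e⟩ := hN y (τ.symm y) (coeff_ne_zero_of_norm_sub_lt hdist y)
    have h1 := congrArg (drop L) e
    rw [drop_iterate_step hL, drop_iterate_step hL] at h1
    replace h1 := (drop_eq_of_le (Nat.le_add_right L k) (hL y)).symm.trans h1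
    have hkl : k = l := by
      have := hy (L + k) (by omega) (L + l) (by omega) h1
      omega
    subst hkl
    obtain ⟨c, rfl⟩ := Nat.exists_eq_add_of_le' hk
    change (step τ.toEquiv)^[c + k] (τ.symm y) = (step τ.toEquiv)^[c + k] y
    rw [Function.iterate_add_apply, e, ← Function.iterate_add_apply]
  refine ⟨N, fun y k hk => ?_⟩
  have h1 := congrArg (itin τ.toEquiv) (hall (τ y))
  rw [itin_iterate_step, itin_iterate_step, τ.symm_apply_apply] at h1
  rw [apply_eq_of_drop_eq h1 (by omega : N ≤ k + 1)]
  have h2 : step τ.toEquiv (τ y) = drop 1 y := by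
    change drop 1 (τ.symm (τ y)) = _
    rw [τ.symm_apply_apply]
  rw [← h2, itin_step]
  rfl

theorem exists_implements_of_mem_weylSet {n : ℕ} (hn : 2 ≤ n) {α : On n ≃⋆ₐ[ℂ] On n}
    (hα : α ∈ weylSet n) : ∃ f ∈ commGroup n, Implements α f := by
  obtain ⟨u, hu, hαu⟩ := hα
  obtain ⟨τ, hτ, huτ⟩ := exists_isLocal_of_mem_permUnitaries hu
  have hα : ∀ i, (α (S i) : Hilb n →L[ℂ] Hilb n) = permOp τ.toEquiv * isomOp i := by
    intro i
    rw [hαu, ← huτ]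
    rfl
  let e : OneSided n ≃ OneSided n :=
    Equiv.ofBijective (itin τ.toEquiv) ⟨injective_itin hα, surjective_itin τ⟩
  let h : OneSided n ≃ₜ OneSided n :=
    Continuous.homeoOfEquivCompactToT2 (f := e) (continuous_itin τ)
  have hh : ∀ y, h y = itin τ.toEquiv y := fun y => rfl
  refine ⟨h.symm, ⟨?_, eventuallyCommutes_itin hn hτ huτ hα⟩, implements_of_S fun i => ?_⟩
  · obtain ⟨L, hL⟩ := IsLocal.symm (f := τ.toEquiv) hτ
    refine ⟨L, fun x k hk => ?_⟩
    -- The itinerary map conjugates `step τ` to the shift, and `step τ` is itself the shift beyond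
    -- `L`.
    have h1 : h.symm (drop 1 x) = step τ.toEquiv (h.symm x) := by
      apply h.injective
      rw [h.apply_symm_apply, hh, itin_step, ← hh, h.apply_symm_apply]
    rw [h1]
    exact (apply_eq_of_drop_eq (hL (h.symm x)) (by omega : L ≤ k + 1)).symm
  · rw [hα]
    apply ext_basisVec
    intro y
    simp only [star_permOp, mul_apply_eq_comp, permOp_basisVec, isomOp_basisVec]
    congr 1
    apply h.injective
    change itin τ.toEquiv (τ.toEquiv (prepend i y)) = h (h.symm (prepend i (h y)))
    rw [itin_apply_prepend, h.apply_symm_apply, hh]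

/-! ### Inner automorphisms -/

theorem mem_innerSet_iff {n : ℕ} (hn : 0 < n) {α : On n ≃⋆ₐ[ℂ] On n}
    {f : OneSided n ≃ₜ OneSided n} (h : Implements α f) : α ∈ innerSet n ↔ IsLocal f := by
  constructor
  · rintro ⟨u, hu, hα⟩
    obtain ⟨g, hg, hug⟩ := exists_isLocal_of_mem_permUnitaries hu
    have hαg : Implements α g := by
      intro a
      rw [hα, ← hug]
      rfl
    rwa [h.unique hαg]
  · intro hf
    obtain ⟨u, hu, huf⟩ := exists_permUnitary_of_isLocal hn hf
    refine ⟨u, hu, fun a => Subtype.ext ?_⟩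
    rw [h a, ← huf]
    rfl

theorem exists_implements_of_mem_innerSet {n : ℕ} {α : On n ≃⋆ₐ[ℂ] On n}
    (hα : α ∈ innerSet n) : ∃ f : OneSided n ≃ₜ OneSided n, IsLocal f ∧ Implements α f := by
  obtain ⟨u, hu, hα⟩ := hα
  obtain ⟨g, hg, hug⟩ := exists_isLocal_of_mem_permUnitaries hu
  refine ⟨g, hg, fun a => ?_⟩
  rw [hα, ← hug]
  rfl

end

end Cuntz

namespace Cuntz

noncomputable section

/-! ### From the one-sided to the two-sided shift -/

/-- The translate `k ↦ z (k + j)`. -/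
def translate {n : ℕ} (j : ℤ) (z : TwoSided n) : TwoSided n := fun k => z (k + j)

theorem translate_apply {n : ℕ} (j : ℤ) (z : TwoSided n) (k : ℤ) : translate j z k = z (k + j) :=
  rfl

@[fun_prop] theorem continuous_translate {n : ℕ} (j : ℤ) : Continuous (translate (n := n) j) :=
  continuous_pi fun k => continuous_apply (k + j)

@[fun_prop] theorem continuous_rightHalf {n : ℕ} : Continuous (rightHalf (n := n)) :=
  continuous_pi fun k => continuous_apply (k : ℤ)

theorem surjective_rightHalf {n : ℕ} : Function.Surjective (rightHalf (n := n)) :=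
  fun x => ⟨fun k => x k.toNat, by funext k; simp [rightHalf]⟩

theorem translate_translate {n : ℕ} (i j : ℤ) (z : TwoSided n) :
    translate i (translate j z) = translate (i + j) z := by
  funext k
  simp [translate_apply, add_assoc]

theorem translate_zero {n : ℕ} (z : TwoSided n) : translate 0 z = z := by
  funext k
  simp [translate_apply]

theorem drop_rightHalf {n : ℕ} (j : ℕ) (z : TwoSided n) :
    drop j (rightHalf z) = rightHalf (translate j z) := by
  funext k
  simp [drop_apply, rightHalf, translate_apply]

/-- The map `γ` commutes with all powers of the shift. -/
def Equivariant {n : ℕ} (γ : TwoSided n → TwoSided n) : Prop :=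
  ∀ j z, γ (translate j z) = translate j (γ z)

theorem Equivariant.comp {n : ℕ} {γ δ : TwoSided n → TwoSided n} (hγ : Equivariant γ)
    (hδ : Equivariant δ) : Equivariant (γ ∘ δ) := by
  intro j z
  simp only [Function.comp_apply]
  rw [hδ, hγ]

theorem equivariant_of_mem {n : ℕ} (g : ShiftAut n) :
    Equivariant (g : TwoSided n ≃ₜ TwoSided n) := by
  have h1 : ∀ z, (g : TwoSided n ≃ₜ TwoSided n) (translate 1 z) =
      translate 1 ((g : TwoSided n ≃ₜ TwoSided n) z) := by
    intro z
    have h := Subgroup.mem_centralizer_iff.mp g.2 (shift n) rfl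
    exact (DFunLike.congr_fun h z).symm
  intro j z
  induction j using Int.induction_on with
  | zero => simp only [translate_zero]
  | succ i ih =>
    rw [add_comm, ← translate_translate, h1, ih, translate_translate]
  | pred i ih =>
    have e : (-(i : ℤ)) = 1 + (-(i : ℤ) - 1) := by ring
    rw [e, ← translate_translate, h1, ← translate_translate] at ih
    have h2 := congrArg (translate (-1)) ih
    simp only [translate_translate] at h2
    simpa [translate_zero, translate_translate, sub_eq_neg_add] using h2

theorem mem_shiftAut_of_equivariant {n : ℕ} {g : TwoSided n ≃ₜ TwoSided n}
    (h : Equivariant g) : g ∈ ShiftAut n := by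
  rw [Subgroup.mem_centralizer_iff]
  rintro _ rfl
  ext1 z
  exact (h 1 z).symm

theorem coe_shiftMem_zpow_apply {n : ℕ} (j : ℤ) (z : TwoSided n) :
    ((shiftMem n ^ j : ShiftAut n) : TwoSided n ≃ₜ TwoSided n) z = translate j z := by
  have hs : ∀ z, shift n z = translate 1 z := fun z => rfl
  have hs' : ∀ z, (shift n)⁻¹ z = translate (-1) z := fun z => rfl
  have h0 : ((shiftMem n ^ j : ShiftAut n) : TwoSided n ≃ₜ TwoSided n) = shift n ^ j := by
    rw [SubgroupClass.coe_zpow]; rfl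
  rw [h0]
  induction j using Int.induction_on with
  | zero => simp [translate_zero]
  | succ i ih =>
    have h0 : ((shiftMem n ^ (i : ℤ) : ShiftAut n) : TwoSided n ≃ₜ TwoSided n)
        = shift n ^ (i : ℤ) := by
      rw [SubgroupClass.coe_zpow]; rfl
    rw [add_comm, zpow_add, zpow_one, Homeomorph.mul_apply, ih h0, hs, translate_translate]
  | pred i ih =>
    have h0 : ((shiftMem n ^ (-(i : ℤ)) : ShiftAut n) : TwoSided n ≃ₜ TwoSided n)
        = shift n ^ (-(i : ℤ)) := by
      rw [SubgroupClass.coe_zpow]; rfl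
    rw [sub_eq_neg_add, zpow_add, zpow_neg_one, Homeomorph.mul_apply, ih h0, hs',
      translate_translate]

/-- `f` and `γ` act in the same way on all coordinates `≥ m`, for some `m`. -/
def Extends {n : ℕ} (f : OneSided n → OneSided n) (γ : TwoSided n → TwoSided n) : Prop :=
  ∃ m : ℕ, ∀ z : TwoSided n, ∀ k : ℕ, m ≤ k → f (rightHalf z) k = γ z k

/-- Equivariance moves any coordinate to position `max a b`, where both maps are given by `f`. -/
theorem Extends.unique {n : ℕ} {f : OneSided n → OneSided n} {γ δ : TwoSided n → TwoSided n}
    (hγ : Extends f γ) (hδ : Extends f δ) (eγ : Equivariant γ) (eδ : Equivariant δ) : γ = δ := by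
  obtain ⟨a, ha⟩ := hγ
  obtain ⟨b, hb⟩ := hδ
  funext z k
  have h := (ha (translate (k - (max a b : ℕ)) z) (max a b) (le_max_left a b)).symm.trans
    (hb (translate (k - (max a b : ℕ)) z) (max a b) (le_max_right a b))
  rw [eγ, eδ, translate_apply, translate_apply] at h
  simpa using h

theorem Extends.comp {n : ℕ} {f f' : OneSided n → OneSided n} {γ γ' : TwoSided n → TwoSided n}
    (hf : EventuallyCommutes f) (h : Extends f γ) (h' : Extends f' γ') :
    Extends (f ∘ f') (γ ∘ γ') := by
  obtain ⟨c, hc⟩ := hf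
  obtain ⟨a, ha⟩ := h
  obtain ⟨b, hb⟩ := h'
  refine ⟨max a (c + b), fun z k hk => ?_⟩
  simp only [Function.comp_apply]
  rw [← ha _ k ((le_max_left _ _).trans hk)]
  refine apply_eq_of_eventuallyCommutes hc (j := b) ?_ ((le_max_right _ _).trans hk)
  rw [drop_eq_iff]
  exact fun i hi => hb z i hi

theorem exists_extension {n : ℕ} {f : OneSided n → OneSided n} (hf : EventuallyCommutes f)
    (hc : Continuous f) : ∃ γ : TwoSided n → TwoSided n, Continuous γ ∧ Equivariant γ ∧
      Extends f γ := by
  obtain ⟨m, hm⟩ := hf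
  -- Coordinate `k` is moved to `m`, the first position from which `f` is known to respect the
  -- shift.
  refine ⟨fun z k => f (rightHalf (translate (k - m) z)) m, ?_, fun j z => ?_, m, fun z k hk => ?_⟩
  · refine continuous_pi fun k => (continuous_apply m).comp (hc.comp ?_)
    exact continuous_rightHalf.comp (continuous_translate _)
  · funext k
    simp only [translate_translate, translate_apply]
    congr 3
    ring_nf
  · obtain ⟨c, rfl⟩ := Nat.exists_eq_add_of_le hk
    rw [apply_add_of_eventuallyCommutes hm c _ le_rfl, drop_rightHalf]
    simp

theorem exists_shiftAut {n : ℕ} (f : commGroup n) :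
    ∃ g : ShiftAut n, EventuallyAgree (f : OneSided n ≃ₜ OneSided n) g := by
  obtain ⟨f, hf⟩ := f
  obtain ⟨γ, hγc, hγe, hγ⟩ := exists_extension hf.1 f.continuous
  obtain ⟨δ, hδc, hδe, hδ⟩ := exists_extension hf.2 f.symm.continuous
  have hid : Extends (id : OneSided n → OneSided n) id := ⟨0, fun z k _ => rfl⟩
  have eid : Equivariant (id : TwoSided n → TwoSided n) := fun _ _ => rfl
  have h1 : δ ∘ γ = id := by
    refine Extends.unique (f := id) ?_ hid (hδe.comp hγe) eid
    have := Extends.comp hf.2 hδ hγ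
    rwa [f.symm_comp_self] at this
  have h2 : γ ∘ δ = id := by
    refine Extends.unique (f := id) ?_ hid (hγe.comp hδe) eid
    have := Extends.comp hf.1 hγ hδ
    rwa [f.self_comp_symm] at this
  let g : TwoSided n ≃ₜ TwoSided n :=
    ⟨⟨γ, δ, fun z => congrFun h1 z, fun z => congrFun h2 z⟩, hγc, hδc⟩
  exact ⟨⟨g, mem_shiftAut_of_equivariant hγe⟩, hγ⟩

theorem eventuallyAgree_unique {n : ℕ} {f : OneSided n ≃ₜ OneSided n} {g g' : ShiftAut n}
    (h : EventuallyAgree f g) (h' : EventuallyAgree f g') : g = g' := by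
  apply Subtype.ext
  ext1 z
  exact congrFun (Extends.unique (f := f) h h' (equivariant_of_mem g) (equivariant_of_mem g')) z

theorem eventuallyAgree_mul {n : ℕ} {f f' : OneSided n ≃ₜ OneSided n}
    {g g' : TwoSided n ≃ₜ TwoSided n} (hf : EventuallyCommutes f) (h : EventuallyAgree f g)
    (h' : EventuallyAgree f' g') : EventuallyAgree (f * f') (g * g') :=
  Extends.comp (f := f) (f' := f') (γ := g) (γ' := g') hf h h'

/-- The two-sided extension of a homeomorphism of `X_n` that eventually commutes with the shift. -/
def toShiftAut (n : ℕ) : commGroup n →* ShiftAut n :=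
  MonoidHom.mk' (fun f => (exists_shiftAut f).choose) fun f f' =>
    eventuallyAgree_unique (exists_shiftAut (f * f')).choose_spec
      (eventuallyAgree_mul f.2.1 (exists_shiftAut f).choose_spec (exists_shiftAut f').choose_spec)

theorem eventuallyAgree_toShiftAut {n : ℕ} (f : commGroup n) :
    EventuallyAgree (f : OneSided n ≃ₜ OneSided n) (toShiftAut n f) :=
  (exists_shiftAut f).choose_spec

/-! ### The kernel: local homeomorphisms -/

/-- The sequences that continue with `y` from the coordinate `m` on. -/
def fiberEquiv {n : ℕ} (m : ℕ) (y : OneSided n) :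
    {x : OneSided n // drop m x = y} ≃ (Fin m → Fin n) where
  toFun x i := x.1 i
  invFun w := ⟨fun k => if h : k < m then w ⟨k, h⟩ else y (k - m), by
    funext k
    simp [drop_apply]⟩
  left_inv := by
    rintro ⟨x, rfl⟩
    apply Subtype.ext
    funext k
    by_cases h : k < m
    · simp [h]
    · simp [h, drop_apply, Nat.sub_add_cancel (not_lt.mp h)]
  right_inv w := by
    funext i
    simp

theorem natCard_fiber {n : ℕ} (m : ℕ) (y : OneSided n) :
    Nat.card {x : OneSided n // drop m x = y} = n ^ m := by
  rw [Nat.card_congr (fiberEquiv m y)]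
  simp

/-- The bijection `f` matches a fibre of `σ^a`, with `n^a` points, to one of `σ^b`, with `n^b`
points. -/
theorem eq_of_drop_comp_eq {n : ℕ} (hn : 2 ≤ n) {f : OneSided n ≃ OneSided n} {a b : ℕ}
    (h : ∀ x, drop b (f x) = drop a x) : a = b := by
  let y : OneSided n := fun _ => ⟨0, by omega⟩
  have e : {x : OneSided n // drop a x = y} ≃ {x : OneSided n // drop b x = y} :=
    f.subtypeEquiv fun x => by rw [h]
  have hc := Nat.card_congr e
  rw [natCard_fiber, natCard_fiber] at hc
  exact Nat.pow_right_injective hn hc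

theorem toShiftAut_mem_shiftPowers_iff {n : ℕ} (hn : 2 ≤ n) (f : commGroup n) :
    toShiftAut n f ∈ shiftPowers n ↔ IsLocal (f : OneSided n ≃ₜ OneSided n) := by
  constructor
  · intro h
    obtain ⟨j, hj⟩ := Subgroup.mem_zpowers_iff.mp h
    obtain ⟨m, hm⟩ := eventuallyAgree_toShiftAut f
    -- Large enough for `f` to agree with `σ^j` from `b` on and for `b + j` to be a natural number.
    let b := max m j.natAbs
    let a := (b + j).toNat
    have hb : (0 : ℤ) ≤ b + j := by omega
    have ha : (a : ℤ) = b + j := Int.toNat_of_nonneg hb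
    have hab : ∀ x, drop b ((f : OneSided n ≃ₜ OneSided n).toEquiv x) = drop a x := by
      intro x
      obtain ⟨z, rfl⟩ := surjective_rightHalf x
      funext k
      rw [drop_apply, drop_apply]
      refine (hm z (k + b) (by omega)).trans ?_
      rw [← hj, coe_shiftMem_zpow_apply, translate_apply, rightHalf]
      congr 1
      push_cast
      omega
    have := eq_of_drop_comp_eq hn hab
    rw [this] at hab
    exact ⟨b, hab⟩
  · rintro ⟨m, hm⟩
    have h1 : EventuallyAgree (f : OneSided n ≃ₜ OneSided n) (1 : ShiftAut n) := by
      refine ⟨m, fun z k hk => ?_⟩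
      rw [apply_eq_of_drop_eq (hm _) hk]
      rfl
    rw [eventuallyAgree_unique (eventuallyAgree_toShiftAut f) h1]
    exact one_mem _

end

end Cuntz

namespace Cuntz

noncomputable section

open scoped Classical

/-! ### Mutual inverses up to a power of the shift -/

theorem exists_memory {n : ℕ} {γ : TwoSided n → TwoSided n} (hc : Continuous γ)
    (he : Equivariant γ) : ∃ r : ℕ, ∀ z z' : TwoSided n,
      (∀ i : ℕ, z i = z' i) → ∀ i : ℕ, r ≤ i → γ z i = γ z' i := by
  obtain ⟨F, hF⟩ := exists_finset_dependence ((continuous_apply (0 : ℤ)).comp hc)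
  -- The radius of the window read by coordinate `0`; moved to `i ≥ r`, the window lies in the right
  -- half.
  refine ⟨F.sup Int.natAbs, fun z z' h i hi => ?_⟩
  have key := hF (translate i z) (translate i z') fun j hj => by
    have h1 : j.natAbs ≤ F.sup Int.natAbs := Finset.le_sup (f := Int.natAbs) hj
    have h2 := h (j + i).toNat
    rwa [Int.toNat_of_nonneg (by omega)] at h2
  simp only [Function.comp_apply] at key
  rw [he, he, translate_apply, translate_apply, zero_add] at key
  exact key

/-- The map `x ↦ γ(z)ᵣ γ(z)ᵣ₊₁ …`, where `z` is an extension of `x` to a two-sided sequence. -/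
def oneSidedMap {n : ℕ} (γ : TwoSided n → TwoSided n) (r : ℕ) (x : OneSided n) : OneSided n :=
  rightHalf (translate r (γ fun k => x k.toNat))

theorem oneSidedMap_rightHalf {n r : ℕ} {γ : TwoSided n → TwoSided n}
    (hr : ∀ z z' : TwoSided n, (∀ i : ℕ, z i = z' i) → ∀ i : ℕ, r ≤ i → γ z i = γ z' i)
    (z : TwoSided n) : oneSidedMap γ r (rightHalf z) = rightHalf (translate r (γ z)) := by
  funext k
  have h := hr (fun k => rightHalf z k.toNat) z (fun i => by simp [rightHalf]) (k + r) (by omega)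
  simpa [oneSidedMap, rightHalf, translate_apply] using h

theorem continuous_oneSidedMap {n : ℕ} {γ : TwoSided n → TwoSided n} (hc : Continuous γ) (r : ℕ) :
    Continuous (oneSidedMap γ r) := by
  refine continuous_rightHalf.comp ((continuous_translate _).comp (hc.comp ?_))
  exact continuous_pi fun k => continuous_apply _

theorem oneSidedMap_drop {n r : ℕ} {γ : TwoSided n → TwoSided n} (he : Equivariant γ)
    (hr : ∀ z z' : TwoSided n, (∀ i : ℕ, z i = z' i) → ∀ i : ℕ, r ≤ i → γ z i = γ z' i)
    (j : ℕ) (x : OneSided n) : oneSidedMap γ r (drop j x) = drop j (oneSidedMap γ r x) := by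
  obtain ⟨z, rfl⟩ := surjective_rightHalf x
  rw [drop_rightHalf, oneSidedMap_rightHalf hr, oneSidedMap_rightHalf hr, drop_rightHalf, he,
    translate_translate, translate_translate, add_comm]

theorem oneSidedMap_comp {n r : ℕ} {γ δ : TwoSided n → TwoSided n} (he : Equivariant γ)
    (hγ : ∀ z z' : TwoSided n, (∀ i : ℕ, z i = z' i) → ∀ i : ℕ, r ≤ i → γ z i = γ z' i)
    (hδ : ∀ z z' : TwoSided n, (∀ i : ℕ, z i = z' i) → ∀ i : ℕ, r ≤ i → δ z i = δ z' i)
    (hinv : ∀ z, γ (δ z) = z) (x : OneSided n) :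
    oneSidedMap γ r (oneSidedMap δ r x) = drop (r + r) x := by
  obtain ⟨z, rfl⟩ := surjective_rightHalf x
  rw [oneSidedMap_rightHalf hδ, oneSidedMap_rightHalf hγ, he, hinv, drop_rightHalf,
    translate_translate]
  push_cast
  rfl

/-- Continuous maps of `X_n` that commute with the shift and are inverse to each other up to its
`p`-th power. -/
structure InversePair {n : ℕ} (p : ℕ) (q q' : OneSided n → OneSided n) : Prop where
  continuous_left : Continuous q
  continuous_right : Continuous q'
  left_drop : ∀ j x, q (drop j x) = drop j (q x)
  right_drop : ∀ j x, q' (drop j x) = drop j (q' x)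
  left_right : ∀ x, q (q' x) = drop p x
  right_left : ∀ x, q' (q x) = drop p x

namespace InversePair

variable {n p : ℕ} {q q' : OneSided n → OneSided n}

theorem symm (h : InversePair p q q') : InversePair p q' q :=
  ⟨h.2, h.1, h.4, h.3, h.6, h.5⟩

/-- The initial segment of length `p`. -/
def initial {n : ℕ} (p : ℕ) (x : OneSided n) : Fin p → Fin n := fun i => x i

/-- The sequence `w y`. -/
def append {n p : ℕ} (w : Fin p → Fin n) (y : OneSided n) : OneSided n :=
  ((fiberEquiv p y).symm w).1

theorem drop_append (w : Fin p → Fin n) (y : OneSided n) : drop p (append w y) = y :=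
  ((fiberEquiv p y).symm w).2

theorem initial_append (w : Fin p → Fin n) (y : OneSided n) : initial p (append w y) = w :=
  (fiberEquiv p y).apply_symm_apply w

theorem ext_initial_drop {x y : OneSided n} (h : initial p x = initial p y)
    (hd : drop p x = drop p y) : x = y := by
  funext k
  by_cases hk : k < p
  · exact congrFun h ⟨k, hk⟩
  · exact apply_eq_of_drop_eq hd (not_lt.mp hk)

theorem append_initial_drop (x : OneSided n) : append (initial p x) (drop p x) = x :=
  ext_initial_drop (initial_append _ _) (drop_append _ _)

theorem continuous_initial {n : ℕ} (p : ℕ) : Continuous (initial (n := n) p) :=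
  continuous_pi fun i => continuous_apply (i : ℕ)

theorem continuous_append (w : Fin p → Fin n) : Continuous (append (n := n) w) := by
  refine continuous_pi fun k => ?_
  by_cases hk : k < p
  · have : (fun y : OneSided n => append w y k) = fun _ => w ⟨k, hk⟩ := by
      funext y; simp [append, fiberEquiv, hk]
    rw [this]
    exact continuous_const
  · have : (fun y : OneSided n => append w y k) = fun y => y (k - p) := by
      funext y; simp [append, fiberEquiv, hk]
    rw [this]
    exact continuous_apply _

/-- The finite data that determine the fibre of `q` over `y`. -/
def fiberData (p : ℕ) (q q' : OneSided n → OneSided n) (y : OneSided n) :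
    ((Fin p → Fin n) → (Fin p → Fin n)) × (Fin p → Fin n) :=
  (fun w => initial p (q (append w (q' y))), initial p y)

theorem continuous_fiberData (h : InversePair p q q') : Continuous (fiberData p q q') := by
  refine Continuous.prodMk (continuous_pi fun w => ?_) (continuous_initial p)
  exact (continuous_initial p).comp
    (h.continuous_left.comp ((continuous_append w).comp h.continuous_right))

/-- The initial segments of the points with given fibre data. -/
def segments (c : ((Fin p → Fin n) → (Fin p → Fin n)) × (Fin p → Fin n)) :
    Finset (Fin p → Fin n) :=
  Finset.univ.filter fun w => c.1 w = c.2

/-- From coordinate `p` on the equation is automatic, as `σ^p q(w q'(y)) = q(q'(y)) = σ^p y`. So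
only the finite data in `fiberData` have to be tested. -/
theorem mem_segments_iff (h : InversePair p q q') (y : OneSided n) (w : Fin p → Fin n) :
    w ∈ segments (fiberData p q q' y) ↔ q (append w (q' y)) = y := by
  rw [segments, Finset.mem_filter]
  simp only [Finset.mem_univ, true_and]
  change initial p (q (append w (q' y))) = initial p y ↔ _
  refine ⟨fun hw => ext_initial_drop hw ?_, fun hw => by rw [hw]⟩
  rw [← h.left_drop, drop_append, h.left_right]

/-- All points of a fibre share the tail `σ^p x = q'(q x) = q'(y)`. -/
theorem append_initial_right (h : InversePair p q q') {x y : OneSided n} (hx : q x = y) :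
    append (initial p x) (q' y) = x := by
  rw [← hx, h.right_left, append_initial_drop]

/-- The points of a fibre of `q` correspond to their initial segments. -/
def fiberEquivSegments (h : InversePair p q q') (y : OneSided n) :
    {x // q x = y} ≃ segments (fiberData p q q' y) where
  toFun x := ⟨initial p x.1, by
    rw [h.mem_segments_iff, h.append_initial_right x.2, x.2]⟩
  invFun w := ⟨append w.1 (q' y), (h.mem_segments_iff y w.1).mp w.2⟩
  left_inv x := Subtype.ext (h.append_initial_right x.2)
  right_inv w := Subtype.ext (initial_append _ _)

/-- The number of points in the fibre of `q` over `y`. -/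
def degree (q : OneSided n → OneSided n) (y : OneSided n) : ℕ := Nat.card {x // q x = y}

theorem finite_fiber (h : InversePair p q q') (y : OneSided n) : Finite {x // q x = y} :=
  Finite.of_equiv _ (h.fiberEquivSegments y).symm

theorem degree_eq_card (h : InversePair p q q') (y : OneSided n) :
    degree q y = (segments (fiberData p q q' y)).card := by
  rw [degree, Nat.card_congr (h.fiberEquivSegments y), Nat.card_eq_fintype_card,
    Fintype.card_coe]

theorem continuous_degree (h : InversePair p q q') : Continuous (degree q) := by
  have : degree q = (fun c => (segments c).card) ∘ fiberData p q q' := funext h.degree_eq_card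
  rw [this]
  exact continuous_of_discreteTopology.comp h.continuous_fiberData

theorem degree_le (h : InversePair p q q') (y : OneSided n) :
    degree q y ≤ Fintype.card (Fin p → Fin n) := by
  rw [h.degree_eq_card]
  exact Finset.card_le_univ _

/-- As `q ∘ q' = σ^p`, the `n^p` points of the fibre of `σ^p` are sorted by their image under `q'`.
-/
theorem sum_degree (h : InversePair p q q') (y : OneSided n) [Fintype {x // q x = y}] :
    ∑ x : {x // q x = y}, degree q' x.1 = n ^ p := by
  have e : {x' : OneSided n // drop p x' = y} ≃
      Σ x : {x // q x = y}, {x' // q' x' = x.1} :=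
    { toFun := fun x' => ⟨⟨q' x'.1, by rw [h.left_right, x'.2]⟩, ⟨x'.1, rfl⟩⟩
      invFun := fun s => ⟨s.2.1, by rw [← h.left_right, s.2.2, s.1.2]⟩
      left_inv := fun x' => rfl
      right_inv := by
        rintro ⟨⟨x, hx⟩, ⟨x', hx'⟩⟩
        change q' x' = x at hx'
        subst hx'
        rfl }
  have : ∀ x : {x // q x = y}, Finite {x' // q' x' = x.1} := fun x => h.symm.finite_fiber x.1
  rw [← natCard_fiber p y, Nat.card_congr e, Nat.card_sigma]
  rfl

/-- The iterated preimages of one point under `σ^p` are dense: prefix that point with longer and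
longer segments of the target. -/
theorem eq_univ_of_drop_mem {B : Set (OneSided n)} (hB : IsClosed B) (hne : B.Nonempty)
    (hp : 0 < p) (hd : ∀ y, drop p y ∈ B → y ∈ B) : B = Set.univ := by
  obtain ⟨b, hb⟩ := hne
  have hk : ∀ (k : ℕ) (y : OneSided n), drop (k * p) y ∈ B → y ∈ B := by
    intro k
    induction k with
    | zero => intro y hy; simpa using hy
    | succ k ih =>
      intro y hy
      refine ih y (hd _ ?_)
      rw [drop_drop]
      convert hy using 2
      ring
  refine Set.eq_univ_of_forall fun y₀ => ?_
  have ht : Filter.Tendsto (fun k => splice (k * p) y₀ b) Filter.atTop (nhds y₀) := by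
    rw [tendsto_pi_nhds]
    intro i
    refine tendsto_const_nhds.congr' ?_
    filter_upwards [Filter.eventually_gt_atTop i] with k hk
    refine (splice_of_lt ?_ _ _).symm
    exact hk.trans_le (Nat.le_mul_of_pos_right k hp)
  refine hB.mem_of_tendsto ht (Filter.Eventually.of_forall fun k => hk k _ ?_)
  rw [drop_splice]
  exact hb

/-- The number of points in a fibre of `q` is constant and divides a power of `n`. -/
theorem exists_degree_eq (h : InversePair p q q') (hn : 0 < n) (hp : 0 < p) :
    ∃ D, D ∣ n ^ p ∧ ∀ y, degree q y = D := by
  have hne : Nonempty (OneSided n) := ⟨fun _ => ⟨0, hn⟩⟩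
  obtain ⟨y₁, hy₁⟩ : ∃ y₁, ∀ y, degree q y ≤ degree q y₁ := by
    have hfin : (Set.range (degree q)).Finite :=
      (Set.finite_Iic (Fintype.card (Fin p → Fin n))).subset (by
        rintro _ ⟨y, rfl⟩
        exact h.degree_le y)
    obtain ⟨_, ⟨y₁, rfl⟩, hm⟩ := hfin.exists_maximal (Set.range_nonempty _)
    exact ⟨y₁, fun y => (le_total (degree q y) (degree q y₁)).elim id
      fun hle => hm ⟨y, rfl⟩ hle⟩
  obtain ⟨x₀, hx₀⟩ : ∃ x₀, ∀ x, degree q' x₀ ≤ degree q' x :=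
    ⟨Function.argmin (degree q'), fun x => Function.argmin_le (degree q') x⟩
  set D := degree q y₁
  set d := degree q' x₀
  have hf : ∀ y, Finite {x // q x = y} := h.finite_fiber
  have hf' : ∀ x, Finite {y // q' y = x} := h.symm.finite_fiber
  have := fun y => Fintype.ofFinite {x // q x = y}
  have := fun x => Fintype.ofFinite {y // q' y = x}
  have hcard : ∀ y, Fintype.card {x // q x = y} = degree q y := fun y => by
    rw [degree, Nat.card_eq_fintype_card]
  have hcard' : ∀ x, Fintype.card {y // q' y = x} = degree q' x := fun x => by
    rw [degree, Nat.card_eq_fintype_card]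
  have hlow : ∀ y, degree q y * d ≤ n ^ p := fun y => by
    rw [← h.sum_degree y, ← hcard, ← smul_eq_mul]
    exact Finset.card_nsmul_le_sum _ _ _ fun x _ => hx₀ x.1
  have hupp : ∀ x, n ^ p ≤ degree q' x * D := fun x => by
    rw [← h.symm.sum_degree x, ← hcard', ← smul_eq_mul]
    exact Finset.sum_le_card_nsmul _ _ _ fun y _ => hy₁ y.1
  -- The largest degree of `q` and the smallest degree of `q'` bound `n^p` from both sides. Hence
  -- all the inequalities over an extremal point are equalities, and extremality spreads from `σ^p
  -- y` to `q' y` and then to `y`.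
  have hDd : D * d = n ^ p := le_antisymm (hlow y₁) (by rw [mul_comm]; exact hupp x₀)
  have hBA : ∀ y, degree q y = D → ∀ x, q x = y → degree q' x = d := by
    intro y hy x hx
    have hs : ∑ x : {x // q x = y}, d = ∑ x : {x // q x = y}, degree q' x.1 := by
      rw [h.sum_degree y, Finset.sum_const, Finset.card_univ, hcard, hy, smul_eq_mul, hDd]
    exact ((Finset.sum_eq_sum_iff_of_le fun x _ => hx₀ x.1).mp hs ⟨x, hx⟩
      (Finset.mem_univ _)).symm
  have hAB : ∀ x, degree q' x = d → ∀ y, q' y = x → degree q y = D := by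
    intro x hx y hy
    have hs : ∑ y : {y // q' y = x}, degree q y.1 = ∑ y : {y // q' y = x}, D := by
      rw [h.symm.sum_degree x, Finset.sum_const, Finset.card_univ, hcard', hx, smul_eq_mul,
        mul_comm, hDd]
    exact (Finset.sum_eq_sum_iff_of_le fun y _ => hy₁ y.1).mp hs ⟨y, hy⟩ (Finset.mem_univ _)
  have huniv : {y | degree q y = D} = Set.univ := by
    refine eq_univ_of_drop_mem (isClosed_eq h.continuous_degree continuous_const) ⟨y₁, rfl⟩ hp ?_
    intro y hy
    exact hAB _ (hBA _ hy _ (h.left_right y)) y rfl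
  exact ⟨D, ⟨d, hDd.symm⟩, fun y => Set.eq_univ_iff_forall.mp huniv y⟩

/-- One labelling is fixed for each finite set of segments, so the label of a point depends only on
finite data, which makes it continuous. -/
theorem exists_labels (p a : ℕ) (hn : 0 < n) : ∃ l : Finset (Fin p → Fin n) →
    (Fin p → Fin n) → (Fin a → Fin n), ∀ E : Finset (Fin p → Fin n), E.card = n ^ a →
      Set.BijOn (l E) E Set.univ := by
  have key : ∀ E : Finset (Fin p → Fin n), ∃ l : (Fin p → Fin n) → (Fin a → Fin n),
      E.card = n ^ a → Set.BijOn l E Set.univ := by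
    intro E
    let c : Fin a → Fin n := fun _ => ⟨0, hn⟩
    by_cases hE : E.card = n ^ a
    · have e : E ≃ (Fin a → Fin n) := Fintype.equivOfCardEq (by simp [hE])
      refine ⟨fun w => if hw : w ∈ E then e ⟨w, hw⟩ else c, fun _ => ⟨fun w _ => trivial, ?_, ?_⟩⟩
      · intro w hw w' hw' hww
        have hw1 : w ∈ E := hw
        have hw2 : w' ∈ E := hw'
        simp only [hw1, hw2, dif_pos] at hww
        exact congrArg Subtype.val (e.injective hww)
      · intro v _
        exact ⟨(e.symm v).1, (e.symm v).2, by simp⟩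
    · exact ⟨fun _ => c, fun h => absurd h hE⟩
  choose l hl using key
  exact ⟨l, hl⟩

/-- If all fibres of `q` have `n ^ a` points, then `q` is a homeomorphism followed by the `a`-th
power of the shift. -/
theorem exists_homeomorph (h : InversePair p q q') (hn : 0 < n) {a : ℕ}
    (ha : ∀ y, degree q y = n ^ a) :
    ∃ f ∈ commGroup n, ∀ x, drop a (f x) = q x := by
  obtain ⟨l, hl⟩ := exists_labels (n := n) p a hn
  have hbij : ∀ y, Set.BijOn (l (segments (fiberData p q q' y)))
      (segments (fiberData p q q' y)) Set.univ := fun y =>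
    hl _ (by rw [← h.degree_eq_card, ha])
  have hmem : ∀ x, initial p x ∈ segments (fiberData p q q' (q x)) := fun x =>
    (h.fiberEquivSegments (q x) ⟨x, rfl⟩).2
  -- The label of `x` within its fibre fills the `a` letters that `σ^a` deletes.
  let F : OneSided n → OneSided n := fun x =>
    append (l (segments (fiberData p q q' (q x))) (initial p x)) (q x)
  have hFd : ∀ x, drop a (F x) = q x := fun x => drop_append _ _
  have hFi : ∀ x, initial a (F x) = l (segments (fiberData p q q' (q x))) (initial p x) :=
    fun x => initial_append _ _
  have hF : Continuous F := by
    have hlab : Continuous fun x => l (segments (fiberData p q q' (q x))) (initial p x) :=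
      (continuous_of_discreteTopology (f := fun s :
        (((Fin p → Fin n) → (Fin p → Fin n)) × (Fin p → Fin n)) × (Fin p → Fin n) =>
          l (segments s.1) s.2)).comp
        ((h.continuous_fiberData.comp h.continuous_left).prodMk (continuous_initial p))
    refine continuous_pi fun k => ?_
    by_cases hk : k < a
    · have : (fun x => F x k) =
          fun x => l (segments (fiberData p q q' (q x))) (initial p x) ⟨k, hk⟩ := by
        funext x
        exact congrFun (hFi x) ⟨k, hk⟩
      rw [this]
      exact (continuous_apply _).comp hlab
    · have : (fun x => F x k) = fun x => q x (k - a) := by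
        funext x
        rw [← hFd x, drop_apply, Nat.sub_add_cancel (not_lt.mp hk)]
      rw [this]
      exact (continuous_apply _).comp h.continuous_left
  have hinj : Function.Injective F := by
    intro x x' hxx
    have h1 : q x = q x' := by rw [← hFd, hxx, hFd]
    have h2 := hFi x
    rw [hxx, hFi x', ← h1] at h2
    have h3 : initial p x = initial p x' :=
      ((hbij (q x)).injOn (h1 ▸ hmem x') (hmem x) h2).symm
    exact ext_initial_drop h3 (by rw [← h.right_left, ← h.right_left, h1])
  have hsurj : Function.Surjective F := by
    intro y
    obtain ⟨w, hw, hwl⟩ := (hbij (drop a y)).surjOn (Set.mem_univ (initial a y))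
    have hq := (h.mem_segments_iff (drop a y) w).mp hw
    refine ⟨append w (q' (drop a y)), ext_initial_drop (p := a) ?_ ?_⟩
    · rw [hFi, hq, initial_append, hwl]
    · rw [hFd, hq]
  let f : OneSided n ≃ₜ OneSided n :=
    Continuous.homeoOfEquivCompactToT2 (f := Equiv.ofBijective F ⟨hinj, hsurj⟩) hF
  have hf : ∀ x, drop a (f x) = q x := hFd
  refine ⟨f, ⟨⟨a, fun x k hk => ?_⟩, ⟨p, fun y k hk => ?_⟩⟩, hf⟩
  · have h1 : drop a (drop 1 (f x)) = drop a (f (drop 1 x)) := by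
      rw [hf, h.left_drop, ← hf, drop_drop, drop_drop, add_comm]
    exact apply_eq_of_drop_eq h1 hk
  · have h2 : ∀ y, drop p (f.symm y) = q' (drop a y) := by
      intro y
      rw [← h.right_left, ← hf, f.apply_symm_apply]
    have h1 : drop p (drop 1 (f.symm y)) = drop p (f.symm (drop 1 y)) := by
      rw [h2, drop_drop, add_comm p 1, ← drop_drop, h2, ← h.right_drop, drop_drop, drop_drop,
        add_comm]
    exact apply_eq_of_drop_eq h1 hk

end InversePair

/-! ### Surjectivity for prime `n` -/

/-- For prime `n`, every automorphism of the two-sided shift is, up to a power of the shift, the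
extension of a homeomorphism of `X_n`. -/
theorem exists_toShiftAut_eq {n : ℕ} (hn : n.Prime) (g : ShiftAut n) :
    ∃ f : commGroup n, ∃ j : ℤ, toShiftAut n f = g * shiftMem n ^ j := by
  have hg := equivariant_of_mem g
  have hg' := equivariant_of_mem g⁻¹
  obtain ⟨r₁, hr₁⟩ := exists_memory (g : TwoSided n ≃ₜ TwoSided n).continuous hg
  obtain ⟨r₂, hr₂⟩ := exists_memory ((g⁻¹ : ShiftAut n) : TwoSided n ≃ₜ TwoSided n).continuous hg'
  -- A common memory for `g` and its inverse; the `+ 1` makes the exponent `p = r + r` positive.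
  let r := r₁ + r₂ + 1
  have m₁ : ∀ z z' : TwoSided n, (∀ i : ℕ, z i = z' i) → ∀ i : ℕ, r ≤ i →
      (g : TwoSided n ≃ₜ TwoSided n) z i = (g : TwoSided n ≃ₜ TwoSided n) z' i :=
    fun z z' h i hi => hr₁ z z' h i (by omega)
  have m₂ : ∀ z z' : TwoSided n, (∀ i : ℕ, z i = z' i) → ∀ i : ℕ, r ≤ i →
      ((g⁻¹ : ShiftAut n) : TwoSided n ≃ₜ TwoSided n) z i =
        ((g⁻¹ : ShiftAut n) : TwoSided n ≃ₜ TwoSided n) z' i :=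
    fun z z' h i hi => hr₂ z z' h i (by omega)
  have hpair : InversePair (r + r) (oneSidedMap (g : TwoSided n ≃ₜ TwoSided n) r)
      (oneSidedMap ((g⁻¹ : ShiftAut n) : TwoSided n ≃ₜ TwoSided n) r) :=
    { continuous_left := continuous_oneSidedMap (Homeomorph.continuous _) r
      continuous_right := continuous_oneSidedMap (Homeomorph.continuous _) r
      left_drop := oneSidedMap_drop hg m₁
      right_drop := oneSidedMap_drop hg' m₂
      left_right := oneSidedMap_comp hg m₁ m₂
        (Homeomorph.apply_symm_apply (g : TwoSided n ≃ₜ TwoSided n))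
      right_left := oneSidedMap_comp hg' m₂ m₁
        (Homeomorph.symm_apply_apply (g : TwoSided n ≃ₜ TwoSided n)) }
  obtain ⟨D, hD, hdeg⟩ := hpair.exists_degree_eq hn.pos (by omega)
  -- Primality enters only here: a divisor of a power of `n` is again a power of `n`.
  obtain ⟨a, -, rfl⟩ := (Nat.dvd_prime_pow hn).mp hD
  obtain ⟨f, hf, hfq⟩ := hpair.exists_homeomorph hn.pos hdeg
  -- Since `σ^a f` is the right half of `σ^r g`, the extension of `f` is `g σ^(r - a)`.
  refine ⟨⟨f, hf⟩, (r : ℤ) - a, eventuallyAgree_unique (eventuallyAgree_toShiftAut _) ?_⟩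
  refine ⟨a, fun z k hk => ?_⟩
  obtain ⟨c, rfl⟩ := Nat.exists_eq_add_of_le' hk
  have h1 := congrFun (hfq (rightHalf z)) c
  rw [oneSidedMap_rightHalf m₁] at h1
  refine h1.trans ?_
  have h2 : ((g * shiftMem n ^ ((r : ℤ) - a) : ShiftAut n) : TwoSided n ≃ₜ TwoSided n) z =
      translate ((r : ℤ) - a) ((g : TwoSided n ≃ₜ TwoSided n) z) := by
    rw [Subgroup.coe_mul, Homeomorph.mul_apply, coe_shiftMem_zpow_apply, hg]
  rw [h2]
  simp only [rightHalf, translate_apply]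
  exact congrArg _ (by push_cast; ring)

end

end Cuntz

namespace Cuntz

noncomputable section

/-! ### The group of automorphisms -/

/-- The action of the homeomorphisms that eventually commute with the shift on `𝒪_n`. -/
def conjHom {n : ℕ} (hn : 0 < n) : commGroup n →* (On n ≃⋆ₐ[ℂ] On n) :=
  MonoidHom.mk' (fun f => (exists_implements hn f.2).choose) fun f g =>
    (exists_implements hn (f * g).2).choose_spec.eq
      ((exists_implements hn f.2).choose_spec.mul (exists_implements hn g.2).choose_spec)

theorem implements_conjHom {n : ℕ} (hn : 0 < n) (f : commGroup n) :
    Implements (conjHom hn f) f :=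
  (exists_implements hn f.2).choose_spec

theorem conjHom_injective {n : ℕ} (hn : 0 < n) : Function.Injective (conjHom hn) := by
  intro f g h
  have hf := implements_conjHom hn f
  rw [h] at hf
  exact Subtype.ext (hf.unique (implements_conjHom hn g))

theorem coe_range_conjHom {n : ℕ} (hn : 2 ≤ n) (h0 : 0 < n) :
    ((conjHom h0).range : Set (On n ≃⋆ₐ[ℂ] On n)) = weylSet n := by
  ext α
  constructor
  · rintro ⟨f, rfl⟩
    exact (implements_conjHom h0 f).mem_weylSet h0 f.2.1
  · intro hα
    obtain ⟨f, hf, h⟩ := exists_implements_of_mem_weylSet hn hα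
    exact ⟨⟨f, hf⟩, (implements_conjHom h0 _).eq h⟩

theorem surjective_mk_toShiftAut {n : ℕ} (hn : n.Prime) : Function.Surjective
    fun f : commGroup n => (QuotientGroup.mk (toShiftAut n f) : ShiftAut n ⧸ shiftPowers n) := by
  intro c
  obtain ⟨g, rfl⟩ := QuotientGroup.mk_surjective c
  obtain ⟨f, j, hf⟩ := exists_toShiftAut_eq hn g
  refine ⟨f, ?_⟩
  simp only
  rw [hf, QuotientGroup.eq, mul_inv_rev, inv_mul_cancel_right]
  exact inv_mem (Subgroup.zpow_mem_zpowers _ j)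

end

end Cuntz

/-! ### The induced homomorphism of quotients -/

theorem kerLift_surjective {G H : Type*} [Group G] [Group H] (φ : G →* H)
    (hφ : Function.Surjective φ) : Function.Surjective (QuotientGroup.kerLift φ) := fun c =>
  (hφ c).elim fun a ha => ⟨QuotientGroup.mk a, ha⟩

theorem theorem4p2 (n : ℕ) (hn : 2 ≤ n) :
    ∃ (W : Subgroup (Cuntz.On n ≃⋆ₐ[ℂ] Cuntz.On n)) (I : Subgroup W) (_ : I.Normal),
      (W : Set (Cuntz.On n ≃⋆ₐ[ℂ] Cuntz.On n)) = Cuntz.weylSet n ∧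
      (fun α : W => (α : Cuntz.On n ≃⋆ₐ[ℂ] Cuntz.On n)) '' (I : Set W) = Cuntz.innerSet n ∧
      ∃ Ψ : W ⧸ I →* Cuntz.ShiftAut n ⧸ Cuntz.shiftPowers n,
        Function.Injective Ψ ∧
        (∀ α : W, ∃ (f : Cuntz.OneSided n ≃ₜ Cuntz.OneSided n) (g : Cuntz.ShiftAut n),
          Cuntz.Induces (α : Cuntz.On n ≃⋆ₐ[ℂ] Cuntz.On n) f ∧
          Cuntz.EventuallyAgree f g ∧
          Ψ (QuotientGroup.mk α) = QuotientGroup.mk g) ∧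
        (n.Prime → Function.Surjective Ψ) := by
  have h0 : 0 < n := by omega
  let e : (Cuntz.conjHom h0).range ≃* Cuntz.commGroup n :=
    (MonoidHom.ofInjective (Cuntz.conjHom_injective h0)).symm
  have he : ∀ α : (Cuntz.conjHom h0).range, Cuntz.Implements (α : Cuntz.On n ≃⋆ₐ[ℂ] Cuntz.On n)
      (e α : Cuntz.OneSided n ≃ₜ Cuntz.OneSided n) := by
    intro α
    have h1 := Cuntz.implements_conjHom h0 (e α)
    rwa [show Cuntz.conjHom h0 (e α) = α from
      MonoidHom.apply_ofInjective_symm (Cuntz.conjHom_injective h0) α] at h1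
  let Φ : (Cuntz.conjHom h0).range →* Cuntz.ShiftAut n ⧸ Cuntz.shiftPowers n :=
    (QuotientGroup.mk' (Cuntz.shiftPowers n)).comp ((Cuntz.toShiftAut n).comp e.toMonoidHom)
  have hΦ : ∀ α, Φ α = QuotientGroup.mk (Cuntz.toShiftAut n (e α)) := fun α => rfl
  have hker : ∀ α, α ∈ Φ.ker ↔ (α : Cuntz.On n ≃⋆ₐ[ℂ] Cuntz.On n) ∈ Cuntz.innerSet n := by
    intro α
    rw [MonoidHom.mem_ker, hΦ, QuotientGroup.eq_one_iff,
      Cuntz.toShiftAut_mem_shiftPowers_iff hn, Cuntz.mem_innerSet_iff h0 (he α)]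
  -- Taking the inner subgroup to be the kernel of `Φ` makes normality and injectivity automatic;
  -- what remains is that this kernel is `innerSet n`.
  refine ⟨(Cuntz.conjHom h0).range, Φ.ker, inferInstance, Cuntz.coe_range_conjHom hn h0, ?_,
    QuotientGroup.kerLift Φ, QuotientGroup.kerLift_injective Φ, fun α => ?_, fun hp => ?_⟩
  · ext β
    constructor
    · rintro ⟨α, hα, rfl⟩
      exact (hker α).mp hα
    · intro hβ
      obtain ⟨f, hf, hfβ⟩ := Cuntz.exists_implements_of_mem_innerSet hβ
      have hmem : β ∈ (Cuntz.conjHom h0).range :=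
        ⟨⟨f, hf.mem_commGroup⟩, (Cuntz.implements_conjHom h0 _).eq hfβ⟩
      exact ⟨⟨β, hmem⟩, (hker ⟨β, hmem⟩).mpr hβ, rfl⟩
  · exact ⟨e α, Cuntz.toShiftAut n (e α), (he α).induces h0,
      Cuntz.eventuallyAgree_toShiftAut (e α), rfl⟩
  · exact kerLift_surjective Φ
      ((Cuntz.surjective_mk_toShiftAut hp).comp e.surjective)
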